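/- Let $n,m\ge 0$ be integers, let $V=V_0\oplus V_1$ be a complex $\mathbb Z_2$-graded vector space with $\dim V_0=n$, $\dim V_1=2m$, equipped with the even supersymmetric bilinear form $(\,,\,)$ that is the standard symmetric form on $V_0$ and the standard symplectic form on $V_1$. Let $\mathfrak g=\mathfrak{gl}(n,2m)=\mathfrak{gl}(V)$, let $\theta$ be the involutive automorphism of $\mathfrak g$ determined by $(\theta(x)v,w)+(-1)^{p(x)p(v)}(v,xw)=0$ for homogeneous $x,v$, and let $\mathfrak k=\mathfrak{osp}(n,2m)=\{x\in\mathfrak g:\theta(x)=x\}$. Modules are $\mathbb Z_2$-graded, irreducibility refers to graded submodules, and isomorphisms are even. For a finite-dimensional $\mathfrak g$-module $U$, let $U^\theta$ be the same graded space with $x$ acting as $\theta(x)$; let $U^*$ be the dual module, $(xl)(u)=-(-1)^{p(x)p(l)}l(xu)$; and let $U^{\mathfrak k}$ be the space of $u\in U$ with $xu=0$ for all $x\in\mathfrak k$. Call $U$ spherical if $U^{\mathfrak k}\ne0$. Let $U(\mathfrak g)$ be the universal enveloping superalgebra, $Z(\mathfrak g)$ its centre, and $y\mapsto y^t$ its principal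 anti-automorphism ($y^t=-y$ for $y\in\mathfrak g$); $U(\mathfrak g)$ acts on $U(\mathfrak g)^*$ by $(yf)(x)=(-1)^{p(y)p(f)}f(y^tx)$. A functional $f\in U(\mathfrak g)^*$ is zonal if $f(xw)=f(wx)=0$ for all $x\in\mathfrak k$, $w\in U(\mathfrak g)$, and zonal spherical if it is zonal, nonzero, and an eigenvector of every $z\in Z(\mathfrak g)$. For $u\in U^{\mathfrak k}$, $l\in (U^*)^{\mathfrak k}$ put $\phi_{u,l}(x)=l(xu)$, $x\in U(\mathfrak g)$, and let $\mathcal Z(U)\subset U(\mathfrak g)^*$ be the linear span of these functions. Theorem. Let $U$ be an irreducible finite-dimensional $\mathfrak g$-module. Then: (1) $U^\theta\cong U^*$; (2) $\dim U^{\mathfrak k}\le 1$; (3) if $U$ is spherical, then $\dim\mathcal Z(U)=1$, the space $\mathcal Z(U)$ is spanned by a zonal spherical function, and $\phi_{u,l}$ is zonal spherical for all nonzero $u\in U^{\mathfrak k}$ and $l\in(U^*)^{\mathfrak k}$. Moreover (3) also holds if throughout $U^{\mathfrak k}$ and $(U^*)^{\mathfrak k}$ are replaced by their subspaces of vectors that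 are in addition fixed by $O(n)\subset OSP(n,2m)$, that is, fixed by $\exp(X)$ for all $X\in\mathfrak{gl}(n)\subset\mathfrak g$ with $\exp(X)\in O(n)$. -/

import Mathlib

open scoped Matrix

noncomputable section

namespace GLOsp

/-! ### Parities and signs -/

/-- The Koszul sign `(-1)^{ij}`. -/
def sgn (i j : ZMod 2) : ℂ := if i = 1 ∧ j = 1 then -1 else 1

theorem zmod_two_cases (i : ZMod 2) : i = 0 ∨ i = 1 := by
  revert i; decide

@[simp] theorem sgn_zero_left (j : ZMod 2) : sgn 0 j = 1 := by simp [sgn]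

@[simp] theorem sgn_zero_right (j : ZMod 2) : sgn j 0 = 1 := by simp [sgn]

@[simp] theorem sgn_one_one : sgn 1 1 = -1 := by simp [sgn]

/-! ### The Lie superalgebra `gl(n,2m)` -/

/-- Index set of the standard basis of `V = V₀ ⊕ V₁`, with `dim V₀ = n` and `dim V₁ = 2m`. -/
abbrev Idx (n m : ℕ) := Fin n ⊕ (Fin m ⊕ Fin m)

/-- Parity of a basis vector of `V`. -/
def idxPar {n m : ℕ} : Idx n m → ZMod 2 := Sum.elim (fun _ => 0) (fun _ => 1)

/-- The underlying vector space of `gl(n,2m)`. -/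
abbrev Gl (n m : ℕ) := Matrix (Idx n m) (Idx n m) ℂ

/-- The homogeneous component of parity `i` of `gl(n,2m)`. -/
def glGr (n m : ℕ) (i : ZMod 2) : Submodule ℂ (Gl n m) where
  carrier := {x | ∀ a b, idxPar a + idxPar b ≠ i → x a b = 0}
  add_mem' hx hy a b h := by simp [hx a b h, hy a b h]
  zero_mem' := by simp
  smul_mem' c x hx a b h := by simp [hx a b h]

/-- For `x` of parity `i` and `y` of parity `j` in an associative superalgebra (in particular in
the matrix superalgebra `gl(n,2m)`), the supercommutator `xy - (-1)^{ij} yx`. -/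
def sbracket {A : Type*} [Ring A] [Algebra ℂ A] (i j : ZMod 2) (x y : A) : A :=
  x * y - sgn i j • (y * x)

/-- Projection of `gl(n,2m)` to its component of parity `i`. -/
def glProj {n m : ℕ} (i : ZMod 2) : Gl n m →ₗ[ℂ] Gl n m where
  toFun x := Matrix.of fun a b => if idxPar a + idxPar b = i then x a b else 0
  map_add' x y := by ext a b; by_cases h : idxPar a + idxPar b = i <;> simp [h]
  map_smul' c x := by ext a b; by_cases h : idxPar a + idxPar b = i <;> simp [h]

theorem glProj_of_mem {n m : ℕ} {i : ZMod 2} {x : Gl n m} (hx : x ∈ glGr n m i) :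
    glProj i x = x := by
  ext a b
  by_cases h : idxPar a + idxPar b = i
  · simp [glProj, h]
  · simp [glProj, h, hx a b h]

theorem glProj_of_mem_ne {n m : ℕ} {i j : ZMod 2} (hij : i ≠ j) {x : Gl n m}
    (hx : x ∈ glGr n m i) : glProj j x = 0 := by
  ext a b
  by_cases h : idxPar a + idxPar b = j
  · simp [glProj, h, hx a b (fun h' => hij (h'.symm.trans h))]
  · simp [glProj, h]

theorem glProj_mem {n m : ℕ} (i : ZMod 2) (x : Gl n m) : glProj i x ∈ glGr n m i := by
  intro a b h
  simp [glProj, h]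

theorem mul_mem_glGr {n m : ℕ} {i j : ZMod 2} {x y : Gl n m} (hx : x ∈ glGr n m i)
    (hy : y ∈ glGr n m j) : x * y ∈ glGr n m (i + j) := by
  intro a b h
  rw [Matrix.mul_apply]
  refine Finset.sum_eq_zero fun c _ => ?_
  by_cases h1 : idxPar a + idxPar c = i
  · by_cases h2 : idxPar c + idxPar b = j
    · exfalso
      apply h
      rw [← h1, ← h2]
      generalize idxPar a = p
      generalize idxPar b = q
      generalize idxPar c = r
      revert p q r
      decide
    · simp [hy c b h2]
  · simp [hx a c h1]

theorem sbracket_mem_glGr {n m : ℕ} {i j : ZMod 2} {x y : Gl n m} (hx : x ∈ glGr n m i)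
    (hy : y ∈ glGr n m j) : sbracket i j x y ∈ glGr n m (i + j) := by
  refine Submodule.sub_mem _ (mul_mem_glGr hx hy) (Submodule.smul_mem _ _ ?_)
  rw [add_comm]
  exact mul_mem_glGr hy hx

theorem eq_blocks_of_even {n m : ℕ} {x : Gl n m} (hx : x ∈ glGr n m 0) :
    x = Matrix.fromBlocks x.toBlocks₁₁ 0 0 x.toBlocks₂₂ := by
  ext a b
  rcases a with a | a <;> rcases b with b | b <;>
    simp [Matrix.toBlocks₁₁, Matrix.toBlocks₂₂]
  · exact hx _ _ (by simp [idxPar])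
  · exact hx _ _ (by simp [idxPar])

theorem eq_blocks_of_odd {n m : ℕ} {x : Gl n m} (hx : x ∈ glGr n m 1) :
    x = Matrix.fromBlocks 0 x.toBlocks₁₂ x.toBlocks₂₁ 0 := by
  ext a b
  rcases a with a | a <;> rcases b with b | b <;>
    simp [Matrix.toBlocks₁₂, Matrix.toBlocks₂₁]
  · exact hx _ _ (by simp [idxPar])
  · exact hx _ _ (by simp only [idxPar, Sum.elim_inr]; decide)

/-! ### The form on `V`, the involution `θ` and `osp(n,2m)` -/

/-- The even supersymmetric form on `V`: the standard symmetric form on `V₀` and the standard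
symplectic form on `V₁`. -/
def form {n m : ℕ} (v w : Idx n m → ℂ) : ℂ :=
  v ⬝ᵥ (Matrix.fromBlocks 1 0 0 (Matrix.J (Fin m) ℂ) *ᵥ w)

/-- The involution `θ` in block form; `form_theta` is its defining relation. -/
def theta {n m : ℕ} : Gl n m →ₗ[ℂ] Gl n m where
  toFun x := Matrix.fromBlocks
    (-(x.toBlocks₁₁)ᵀ) (-((x.toBlocks₂₁)ᵀ * Matrix.J (Fin m) ℂ))
    (-(Matrix.J (Fin m) ℂ * (x.toBlocks₁₂)ᵀ))
    (Matrix.J (Fin m) ℂ * (x.toBlocks₂₂)ᵀ * Matrix.J (Fin m) ℂ)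
  map_add' x y := by
    have h11 : (x + y).toBlocks₁₁ = x.toBlocks₁₁ + y.toBlocks₁₁ := rfl
    have h12 : (x + y).toBlocks₁₂ = x.toBlocks₁₂ + y.toBlocks₁₂ := rfl
    have h21 : (x + y).toBlocks₂₁ = x.toBlocks₂₁ + y.toBlocks₂₁ := rfl
    have h22 : (x + y).toBlocks₂₂ = x.toBlocks₂₂ + y.toBlocks₂₂ := rfl
    rw [h11, h12, h21, h22, Matrix.fromBlocks_add]
    congr 1 <;> simp [Matrix.add_mul, Matrix.mul_add, add_comm]
  map_smul' c x := by
    have h11 : (c • x).toBlocks₁₁ = c • x.toBlocks₁₁ := rfl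
    have h12 : (c • x).toBlocks₁₂ = c • x.toBlocks₁₂ := rfl
    have h21 : (c • x).toBlocks₂₁ = c • x.toBlocks₂₁ := rfl
    have h22 : (c • x).toBlocks₂₂ = c • x.toBlocks₂₂ := rfl
    rw [h11, h12, h21, h22, RingHom.id_apply, Matrix.fromBlocks_smul]
    congr 1 <;> simp

theorem theta_fromBlocks {n m : ℕ} (A : Matrix (Fin n) (Fin n) ℂ) (B C D) :
    theta (n := n) (m := m) (Matrix.fromBlocks A B C D) = Matrix.fromBlocks
      (-Aᵀ) (-(Cᵀ * Matrix.J (Fin m) ℂ)) (-(Matrix.J (Fin m) ℂ * Bᵀ))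
      (Matrix.J (Fin m) ℂ * Dᵀ * Matrix.J (Fin m) ℂ) := rfl

theorem J_mul_J_mul {m : ℕ} {ι : Type*} (A : Matrix (Fin m ⊕ Fin m) ι ℂ) :
    Matrix.J (Fin m) ℂ * (Matrix.J (Fin m) ℂ * A) = -A := by
  rw [← Matrix.mul_assoc, Matrix.J_squared]; simp

/-- A vector of `V` has parity `j`. -/
def VHom {n m : ℕ} (j : ZMod 2) (v : Idx n m → ℂ) : Prop := ∀ a, idxPar a ≠ j → v a = 0

/-- The defining relation `(θ(x)v, w) + (-1)^{p(x)p(v)} (v, xw) = 0` of `θ`. -/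
theorem form_theta {n m : ℕ} (i j : ZMod 2) (x : Gl n m) (hx : x ∈ glGr n m i)
    (v w : Idx n m → ℂ) (hv : VHom j v) :
    form (theta x *ᵥ v) w + sgn i j * form v (x *ᵥ w) = 0 := by
  have hform : ∀ A : Gl n m, form (A *ᵥ v) w =
      v ⬝ᵥ ((Aᵀ * Matrix.fromBlocks 1 0 0 (Matrix.J (Fin m) ℂ)) *ᵥ w) := by
    intro A
    rw [form, ← Matrix.mulVec_mulVec, Matrix.dotProduct_mulVec v, Matrix.vecMul_transpose]
  have hform' : form v (x *ᵥ w) =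
      v ⬝ᵥ ((Matrix.fromBlocks 1 0 0 (Matrix.J (Fin m) ℂ) * x) *ᵥ w) := by
    rw [form, Matrix.mulVec_mulVec]
  rw [hform, hform']
  rcases zmod_two_cases i with rfl | rfl
  · rw [eq_blocks_of_even hx, theta_fromBlocks]
    simp [Matrix.fromBlocks_transpose, Matrix.fromBlocks_multiply, Matrix.transpose_mul,
      Matrix.mul_assoc, Matrix.J_squared, Matrix.J_transpose]
    rw [← dotProduct_add, ← Matrix.add_mulVec, Matrix.fromBlocks_add]
    simp
  · rw [eq_blocks_of_odd hx, theta_fromBlocks]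
    have hw : w = Sum.elim (w ∘ Sum.inl) (w ∘ Sum.inr) := by
      ext a; rcases a with a | a <;> rfl
    have hv' : v = Sum.elim (v ∘ Sum.inl) (v ∘ Sum.inr) := by
      ext a; rcases a with a | a <;> rfl
    rcases zmod_two_cases j with rfl | rfl
    · have h0 : v ∘ Sum.inr = 0 := by
        ext a; exact hv (Sum.inr a) (by simp [idxPar])
      rw [h0] at hv'
      rw [hw, hv']
      simp [Matrix.fromBlocks_transpose, Matrix.fromBlocks_multiply, Matrix.transpose_mul,
        Matrix.mul_assoc, Matrix.J_squared, Matrix.J_transpose, Matrix.fromBlocks_mulVec,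
        Matrix.neg_mulVec]
    · have h0 : v ∘ Sum.inl = 0 := by
        ext a; exact hv (Sum.inl a) (by simp [idxPar])
      rw [h0] at hv'
      rw [hw, hv']
      simp [Matrix.fromBlocks_transpose, Matrix.fromBlocks_multiply, Matrix.transpose_mul,
        Matrix.mul_assoc, Matrix.J_squared, Matrix.J_transpose, Matrix.fromBlocks_mulVec,
        Matrix.neg_mulVec]

theorem theta_theta {n m : ℕ} (x : Gl n m) : theta (theta x) = x := by
  rw [← Matrix.fromBlocks_toBlocks x, theta_fromBlocks, theta_fromBlocks]
  simp [Matrix.transpose_mul, Matrix.mul_assoc, Matrix.J_transpose, J_mul_J_mul, Matrix.J_squared]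

theorem theta_mem {n m : ℕ} {i : ZMod 2} {x : Gl n m} (hx : x ∈ glGr n m i) :
    theta x ∈ glGr n m i := by
  rcases zmod_two_cases i with rfl | rfl
  · rw [eq_blocks_of_even hx, theta_fromBlocks]
    intro a b h
    rcases a with a | a <;> rcases b with b | b <;> simp [idxPar] at h ⊢
    exact absurd (by decide) h
  · rw [eq_blocks_of_odd hx, theta_fromBlocks]
    intro a b h
    rcases a with a | a <;> rcases b with b | b <;> simp [idxPar] at h ⊢

theorem theta_sbracket {n m : ℕ} {i j : ZMod 2} {x y : Gl n m} (hx : x ∈ glGr n m i)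
    (hy : y ∈ glGr n m j) :
    theta (sbracket i j x y) = sbracket i j (theta x) (theta y) := by
  rcases zmod_two_cases i with rfl | rfl <;> rcases zmod_two_cases j with rfl | rfl
  · rw [eq_blocks_of_even hx, eq_blocks_of_even hy]
    simp [sbracket, theta_fromBlocks, Matrix.fromBlocks_multiply, sub_eq_add_neg,
      Matrix.fromBlocks_neg, Matrix.fromBlocks_add,
      Matrix.transpose_mul, Matrix.mul_assoc, J_mul_J_mul, Matrix.mul_add, Matrix.add_mul, add_comm]
  · rw [eq_blocks_of_even hx, eq_blocks_of_odd hy]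
    simp [sbracket, theta_fromBlocks, Matrix.fromBlocks_multiply, sub_eq_add_neg,
      Matrix.fromBlocks_neg, Matrix.fromBlocks_add,
      Matrix.transpose_mul, Matrix.mul_assoc, J_mul_J_mul, Matrix.mul_add, Matrix.add_mul, add_comm]
  · rw [eq_blocks_of_odd hx, eq_blocks_of_even hy]
    simp [sbracket, theta_fromBlocks, Matrix.fromBlocks_multiply, sub_eq_add_neg,
      Matrix.fromBlocks_neg, Matrix.fromBlocks_add,
      Matrix.transpose_mul, Matrix.mul_assoc, J_mul_J_mul, Matrix.mul_add, Matrix.add_mul, add_comm]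
  · rw [eq_blocks_of_odd hx, eq_blocks_of_odd hy]
    simp [sbracket, theta_fromBlocks, Matrix.fromBlocks_multiply, sub_eq_add_neg,
      Matrix.fromBlocks_neg, Matrix.fromBlocks_add,
      Matrix.transpose_mul, Matrix.mul_assoc, J_mul_J_mul, Matrix.mul_add, Matrix.add_mul, add_comm]

/-- `osp(n,2m)`, the fixed points of `θ`. -/
def osp (n m : ℕ) : Submodule ℂ (Gl n m) where
  carrier := {x | theta x = x}
  add_mem' {x y} hx hy := by
    simp only [Set.mem_ofPred_eq] at hx hy ⊢
    rw [map_add, hx, hy]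
  zero_mem' := by simp
  smul_mem' c x hx := by
    simp only [Set.mem_ofPred_eq] at hx ⊢
    rw [map_smul, hx]

/-! ### The universal enveloping superalgebra -/

/-- The defining relations `xy - (-1)^{p(x)p(y)} yx = [x,y]` of `U(gl(n,2m))`. -/
inductive UgRel (n m : ℕ) : TensorAlgebra ℂ (Gl n m) → TensorAlgebra ℂ (Gl n m) → Prop
  | mk (i j : ZMod 2) (x y : Gl n m) (hx : x ∈ glGr n m i) (hy : y ∈ glGr n m j) :
      UgRel n m (sbracket i j (TensorAlgebra.ι ℂ x) (TensorAlgebra.ι ℂ y))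
        (TensorAlgebra.ι ℂ (sbracket i j x y))

/-- The universal enveloping algebra `U(gl(n,2m))`. -/
def Ug (n m : ℕ) := (ringConGen (UgRel n m)).Quotient

instance (n m : ℕ) : Ring (Ug n m) := inferInstanceAs (Ring (ringConGen (UgRel n m)).Quotient)

instance (n m : ℕ) : Algebra ℂ (Ug n m) :=
  inferInstanceAs (Algebra ℂ (ringConGen (UgRel n m)).Quotient)

/-- The quotient map from the tensor algebra to `U(gl(n,2m))`. -/
def ugMk (n m : ℕ) : TensorAlgebra ℂ (Gl n m) →ₐ[ℂ] Ug n m := RingCon.mkₐ ℂ (ringConGen (UgRel n m))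

/-- The canonical map `gl(n,2m) → U(gl(n,2m))`. -/
def ugι {n m : ℕ} : Gl n m →ₗ[ℂ] Ug n m := (ugMk n m).toLinearMap ∘ₗ TensorAlgebra.ι ℂ

theorem ugι_sbracket {n m : ℕ} {i j : ZMod 2} {x y : Gl n m} (hx : x ∈ glGr n m i)
    (hy : y ∈ glGr n m j) : ugι (sbracket i j x y) = sbracket i j (ugι x) (ugι y) := by
  have : ugMk n m (sbracket i j (TensorAlgebra.ι ℂ x) (TensorAlgebra.ι ℂ y)) =
      ugMk n m (TensorAlgebra.ι ℂ (sbracket i j x y)) :=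
    Quotient.sound (RingCon.le_ringConGen _ _ (UgRel.mk i j x y hx hy))
  simp only [ugι, LinearMap.comp_apply, AlgHom.toLinearMap_apply]
  rw [← this]
  simp [sbracket]

/-- The universal property of `U(gl(n,2m))`. -/
def ugLift {n m : ℕ} {A : Type*} [Ring A] [Algebra ℂ A] (f : Gl n m →ₗ[ℂ] A)
    (hf : ∀ (i j : ZMod 2) (x y : Gl n m), x ∈ glGr n m i → y ∈ glGr n m j →
      f (sbracket i j x y) = sbracket i j (f x) (f y)) : Ug n m →ₐ[ℂ] A :=
  RingCon.liftₐ (ringConGen (UgRel n m)) (TensorAlgebra.lift ℂ f) (by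
    grw [RingCon.ringConGen_le]
    rintro _ _ ⟨i, j, x, y, hx, hy⟩
    change TensorAlgebra.lift ℂ f _ = TensorAlgebra.lift ℂ f _
    rw [TensorAlgebra.lift_ι_apply, hf i j x y hx hy]
    simp [sbracket])

@[simp] theorem ugLift_ugι {n m : ℕ} {A : Type*} [Ring A] [Algebra ℂ A] (f : Gl n m →ₗ[ℂ] A)
    (hf : ∀ (i j : ZMod 2) (x y : Gl n m), x ∈ glGr n m i → y ∈ glGr n m j →
      f (sbracket i j x y) = sbracket i j (f x) (f y)) (x : Gl n m) :
    ugLift f hf (ugι x) = f x := by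
  change TensorAlgebra.lift ℂ f (TensorAlgebra.ι ℂ x) = f x
  simp

/-- The parity automorphism of `U(gl(n,2m))`, equal to `(-1)^{p(x)} x` on homogeneous `x`. -/
def ugPar {n m : ℕ} : Ug n m →ₐ[ℂ] Ug n m :=
  ugLift (ugι ∘ₗ (glProj 0 - glProj 1)) (by
    intro i j x y hx hy
    have hxy := sbracket_mem_glGr hx hy
    have key := ugι_sbracket hx hy
    have h10 : (1 : ZMod 2) ≠ 0 := by decide
    have h01 : (0 : ZMod 2) ≠ 1 := by decide
    rcases zmod_two_cases i with rfl | rfl <;> rcases zmod_two_cases j with rfl | rfl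
    · rw [zero_add] at hxy
      simp [glProj_of_mem hxy, glProj_of_mem_ne h01 hxy, glProj_of_mem hx,
        glProj_of_mem_ne h01 hx, glProj_of_mem hy, glProj_of_mem_ne h01 hy, key]
    · rw [zero_add] at hxy
      simp [glProj_of_mem hxy, glProj_of_mem_ne h10 hxy, glProj_of_mem hx,
        glProj_of_mem_ne h01 hx, glProj_of_mem hy, glProj_of_mem_ne h10 hy, key]
      simp [sbracket]
      abel
    · rw [add_zero] at hxy
      simp [glProj_of_mem hxy, glProj_of_mem_ne h10 hxy, glProj_of_mem hx,
        glProj_of_mem_ne h10 hx, glProj_of_mem hy, glProj_of_mem_ne h01 hy, key]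
      simp [sbracket]
      abel
    · rw [show (1 : ZMod 2) + 1 = 0 by decide] at hxy
      simp [glProj_of_mem hxy, glProj_of_mem_ne h01 hxy, glProj_of_mem hx,
        glProj_of_mem_ne h10 hx, glProj_of_mem hy, glProj_of_mem_ne h10 hy, key]
      simp [sbracket])

theorem ugPar_ugι_even {n m : ℕ} {x : Gl n m} (hx : x ∈ glGr n m 0) :
    ugPar (ugι x) = ugι x := by
  simp [ugPar, glProj_of_mem hx, glProj_of_mem_ne (show (0 : ZMod 2) ≠ 1 by decide) hx]

theorem ugPar_ugι_odd {n m : ℕ} {x : Gl n m} (hx : x ∈ glGr n m 1) :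
    ugPar (ugι x) = -ugι x := by
  simp [ugPar, glProj_of_mem hx, glProj_of_mem_ne (show (1 : ZMod 2) ≠ 0 by decide) hx]

theorem ugPar_ugPar {n m : ℕ} (w : Ug n m) : ugPar (ugPar w) = w := by
  have h : (ugPar.comp ugPar : Ug n m →ₐ[ℂ] Ug n m) = AlgHom.id ℂ _ := by
    apply RingCon.Quotient.hom_extₐ
    apply TensorAlgebra.hom_ext
    ext1 x
    change ugPar (ugPar (ugι x)) = ugι x
    have hx : x = glProj 0 x + glProj 1 x := by
      ext a b
      rcases zmod_two_cases (idxPar a + idxPar b) with h | h <;> simp [glProj, h]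
    rw [hx]
    simp only [map_add, ugPar_ugι_even (glProj_mem 0 x), ugPar_ugι_odd (glProj_mem 1 x), map_neg,
      neg_neg]
  exact DFunLike.congr_fun h w

/-- The component of parity `i` of an element of `U(gl(n,2m))`. -/
def ugComp {n m : ℕ} (i : ZMod 2) (w : Ug n m) : Ug n m :=
  (2 : ℂ)⁻¹ • (w + sgn i 1 • ugPar w)

/-- Auxiliary for the principal anti-automorphism: `y ∈ gl(n,2m)` of parity `i` acts on
`U(gl(n,2m))` by `w ↦ -(-1)^{i p(w)} w y`. -/
def ugRight {n m : ℕ} : Gl n m →ₗ[ℂ] Module.End ℂ (Ug n m) :=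
  -((LinearMap.mul ℂ (Ug n m)).flip ∘ₗ ugι ∘ₗ glProj 0)
    - (LinearMap.lcomp ℂ (Ug n m) ugPar.toLinearMap) ∘ₗ
      ((LinearMap.mul ℂ (Ug n m)).flip ∘ₗ ugι ∘ₗ glProj 1)

theorem ugRight_even {n m : ℕ} {y : Gl n m} (hy : y ∈ glGr n m 0) (w : Ug n m) :
    ugRight y w = -(w * ugι y) := by
  simp [ugRight, glProj_of_mem hy, glProj_of_mem_ne (show (0 : ZMod 2) ≠ 1 by decide) hy]

theorem ugRight_odd {n m : ℕ} {y : Gl n m} (hy : y ∈ glGr n m 1) (w : Ug n m) :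
    ugRight y w = -(ugPar w * ugι y) := by
  simp [ugRight, glProj_of_mem hy, glProj_of_mem_ne (show (1 : ZMod 2) ≠ 0 by decide) hy]

theorem ugRight_sbracket {n m : ℕ} (i j : ZMod 2) (x y : Gl n m) (hx : x ∈ glGr n m i)
    (hy : y ∈ glGr n m j) :
    ugRight (sbracket i j x y) = sbracket i j (ugRight x) (ugRight y) := by
  have hxy := sbracket_mem_glGr hx hy
  have key := ugι_sbracket hx hy
  refine LinearMap.ext fun w => ?_
  rcases zmod_two_cases i with rfl | rfl <;> rcases zmod_two_cases j with rfl | rfl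
  · rw [zero_add] at hxy
    rw [ugRight_even hxy, key]
    simp [sbracket, ugRight_even hx, ugRight_even hy, mul_sub, mul_assoc]
  · rw [zero_add] at hxy
    rw [ugRight_odd hxy, key]
    simp [sbracket, ugRight_even hx, ugRight_odd hy, mul_sub, mul_assoc, ugPar_ugι_even hx]
  · rw [add_zero] at hxy
    rw [ugRight_odd hxy, key]
    simp [sbracket, ugRight_odd hx, ugRight_even hy, mul_sub, mul_assoc, ugPar_ugι_even hy]
  · rw [show (1 : ZMod 2) + 1 = 0 by decide] at hxy
    rw [ugRight_even hxy, key]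
    simp [sbracket, ugRight_odd hx, ugRight_odd hy, mul_add, mul_assoc, ugPar_ugι_odd hx,
      ugPar_ugι_odd hy, ugPar_ugPar]

/-- The principal anti-automorphism `y ↦ yᵗ` of the superalgebra `U(gl(n,2m))`, determined by
`1ᵗ = 1`, `yᵗ = -y` for `y ∈ gl(n,2m)` and `(yw)ᵗ = (-1)^{p(y)p(w)} wᵗ yᵗ`. -/
def ugT {n m : ℕ} (y : Ug n m) : Ug n m := ugLift ugRight ugRight_sbracket y 1

theorem ugT_one {n m : ℕ} : ugT (1 : Ug n m) = 1 := by simp [ugT]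

theorem ugT_ugι {n m : ℕ} (y : Gl n m) : ugT (ugι y) = -ugι y := by
  have hy : y = glProj 0 y + glProj 1 y := by
    ext a b
    rcases zmod_two_cases (idxPar a + idxPar b) with h | h <;> simp [glProj, h]
  have h : ugT (ugι y) = ugRight y 1 := by simp [ugT]
  rw [h, hy, map_add, LinearMap.add_apply, ugRight_even (glProj_mem 0 y),
    ugRight_odd (glProj_mem 1 y)]
  simp [add_comm]

theorem ugT_ugι_mul_even {n m : ℕ} {y : Gl n m} (hy : y ∈ glGr n m 0) (w : Ug n m) :
    ugT (ugι y * w) = ugT w * ugT (ugι y) := by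
  rw [ugT_ugι, mul_neg, ← ugRight_even hy]
  simp [ugT]

theorem ugT_ugι_mul_odd {n m : ℕ} {y : Gl n m} (hy : y ∈ glGr n m 1) (w : Ug n m) :
    ugT (ugι y * w) = ugPar (ugT w) * ugT (ugι y) := by
  rw [ugT_ugι, mul_neg, ← ugRight_odd hy]
  simp [ugT]

/-! ### The dual of `U(gl(n,2m))`, zonal and zonal spherical functions -/

/-- The full dual `U(gl(n,2m))^*`. -/
abbrev UgDual (n m : ℕ) := Module.Dual ℂ (Ug n m)

/-- The component of parity `j` of a functional; a functional has parity `j` if it vanishes on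
elements of parity other than `j`. -/
def dualComp {n m : ℕ} (j : ZMod 2) (f : UgDual n m) : UgDual n m :=
  (2 : ℂ)⁻¹ • (f + sgn j 1 • (f ∘ₗ ugPar.toLinearMap))

/-- The action `(y f)(x) = (-1)^{p(y)p(f)} f(yᵗ x)` of `U(gl(n,2m))` on its dual, extended
bilinearly from homogeneous `y` and `f`. -/
def dualAct {n m : ℕ} (y : Ug n m) (f : UgDual n m) : UgDual n m :=
  ∑ i : ZMod 2, ∑ j : ZMod 2,
    sgn i j • (dualComp j f ∘ₗ LinearMap.mulLeft ℂ (ugT (ugComp i y)))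

/-- Zonal functions: two-sided `osp(n,2m)`-invariant functionals on `U(gl(n,2m))`. -/
def IsZonal {n m : ℕ} (f : UgDual n m) : Prop :=
  ∀ x ∈ osp n m, ∀ w : Ug n m, f (ugι x * w) = 0 ∧ f (w * ugι x) = 0

/-- Zonal spherical functions: zonal functions which are (nonzero) joint eigenvectors of the centre
of `U(gl(n,2m))`. -/
def IsZonalSpherical {n m : ℕ} (f : UgDual n m) : Prop :=
  IsZonal f ∧ f ≠ 0 ∧ ∀ z ∈ Subalgebra.center ℂ (Ug n m), ∃ c : ℂ, dualAct z f = c • f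

/-! ### Modules over `gl(n,2m)` -/

/-- A `ℤ/2`-graded `gl(n,2m)`-module structure on a complex vector space `U`. -/
structure GLModule (n m : ℕ) (U : Type*) [AddCommGroup U] [Module ℂ U] where
  /-- the homogeneous components of `U` -/
  gr : ZMod 2 → Submodule ℂ U
  isCompl : IsCompl (gr 0) (gr 1)
  /-- the action -/
  act : Gl n m →ₗ[ℂ] Module.End ℂ U
  act_mem : ∀ (i j : ZMod 2), ∀ x ∈ glGr n m i, ∀ u ∈ gr j, act x u ∈ gr (i + j)
  act_sbracket : ∀ (i j : ZMod 2) (x y : Gl n m), x ∈ glGr n m i → y ∈ glGr n m j →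
    act (sbracket i j x y) = sbracket i j (act x) (act y)

namespace GLModule

variable {n m : ℕ} {U : Type*} [AddCommGroup U] [Module ℂ U]

/-- Irreducibility: `U ≠ 0` and there are no graded submodules besides `0` and `U`. -/
def IsIrreducible (M : GLModule n m U) : Prop :=
  Nontrivial U ∧ ∀ W : Submodule ℂ U, W ≤ (W ⊓ M.gr 0) ⊔ (W ⊓ M.gr 1) →
    (∀ x : Gl n m, ∀ u ∈ W, M.act x u ∈ W) → W = ⊥ ∨ W = ⊤

/-- An isomorphism of graded modules: a bijective linear map preserving parity and commuting with
the action. -/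
def IsIsomorphic {U' : Type*} [AddCommGroup U'] [Module ℂ U'] (M : GLModule n m U)
    (M' : GLModule n m U') : Prop :=
  ∃ e : U ≃ₗ[ℂ] U', (∀ i, ∀ u ∈ M.gr i, e u ∈ M'.gr i) ∧
    ∀ (x : Gl n m) (u : U), e (M.act x u) = M'.act x (e u)

/-- The module `U^θ`: the same graded space with `x` acting as `θ(x)`. -/
def twist (M : GLModule n m U) : GLModule n m U where
  gr := M.gr
  isCompl := M.isCompl
  act := M.act ∘ₗ theta
  act_mem i j x hx u hu := M.act_mem i j _ (theta_mem hx) u hu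
  act_sbracket i j x y hx hy := by
    simp only [LinearMap.comp_apply]
    rw [theta_sbracket hx hy, M.act_sbracket i j _ _ (theta_mem hx) (theta_mem hy)]

/-- The parity operator `u ↦ (-1)^{p(u)} u`. -/
def par (M : GLModule n m U) : Module.End ℂ U :=
  (M.gr 0).projection (M.gr 1) M.isCompl - (M.gr 1).projection (M.gr 0) M.isCompl.symm

theorem par_even (M : GLModule n m U) {u : U} (hu : u ∈ M.gr 0) : M.par u = u := by
  have h1 := Submodule.projection_apply_of_mem_left M.isCompl hu
  have h2 : (M.gr 1).projection (M.gr 0) M.isCompl.symm u = 0 := by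
    rw [Submodule.projection_apply_eq_zero_iff]; exact hu
  simp only [par, LinearMap.sub_apply, h1, h2, sub_zero]

theorem par_odd (M : GLModule n m U) {u : U} (hu : u ∈ M.gr 1) : M.par u = -u := by
  have h1 := Submodule.projection_apply_of_mem_left M.isCompl.symm hu
  have h2 : (M.gr 0).projection (M.gr 1) M.isCompl u = 0 := by
    rw [Submodule.projection_apply_eq_zero_iff]; exact hu
  simp only [par, LinearMap.sub_apply, h1, h2, zero_sub]

theorem ext_hom (M : GLModule n m U) {V : Type*} [AddCommGroup V] [Module ℂ V]
    {f g : U →ₗ[ℂ] V} (h : ∀ i, ∀ u ∈ M.gr i, f u = g u) : f = g := by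
  refine LinearMap.ext fun u => ?_
  have hu : u ∈ M.gr 0 ⊔ M.gr 1 := by rw [M.isCompl.sup_eq_top]; trivial
  obtain ⟨a, ha, b, hb, rfl⟩ := Submodule.mem_sup.mp hu
  rw [map_add, map_add, h 0 a ha, h 1 b hb]

theorem par_par (M : GLModule n m U) : M.par ∘ₗ M.par = LinearMap.id := by
  refine M.ext_hom fun i u hu => ?_
  rcases zmod_two_cases i with rfl | rfl
  · simp [M.par_even hu]
  · simp [M.par_odd hu]

theorem par_act_even (M : GLModule n m U) {x : Gl n m} (hx : x ∈ glGr n m 0) :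
    M.par ∘ₗ M.act x = M.act x ∘ₗ M.par := by
  refine M.ext_hom fun i u hu => ?_
  have h := M.act_mem 0 i x hx u hu
  rw [zero_add] at h
  rcases zmod_two_cases i with rfl | rfl
  · simp [M.par_even hu, M.par_even h]
  · simp [M.par_odd hu, M.par_odd h]

theorem par_act_odd (M : GLModule n m U) {x : Gl n m} (hx : x ∈ glGr n m 1) :
    M.par ∘ₗ M.act x = -(M.act x ∘ₗ M.par) := by
  refine M.ext_hom fun i u hu => ?_
  have h := M.act_mem 1 i x hx u hu
  rcases zmod_two_cases i with rfl | rfl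
  · rw [add_zero] at h
    simp [M.par_even hu, M.par_odd h]
  · rw [show (1 : ZMod 2) + 1 = 0 by decide] at h
    simp [M.par_odd hu, M.par_even h]

/-- The functionals of parity `i`. -/
def dualGr (M : GLModule n m U) (i : ZMod 2) : Submodule ℂ (Module.Dual ℂ U) where
  carrier := {f | ∀ j, j ≠ i → ∀ u ∈ M.gr j, f u = 0}
  add_mem' hf hg j hj u hu := by simp [hf j hj u hu, hg j hj u hu]
  zero_mem' := by simp
  smul_mem' c f hf j hj u hu := by simp [hf j hj u hu]

/-- The dual action; `dualAction_apply` is the usual formula. -/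
def dualAction (M : GLModule n m U) : Gl n m →ₗ[ℂ] Module.End ℂ (Module.Dual ℂ U) where
  toFun x := -(LinearMap.lcomp ℂ ℂ (M.act (glProj 0 x)))
    - LinearMap.lcomp ℂ ℂ (M.par ∘ₗ M.act (glProj 1 x))
  map_add' x y := by
    ext f u
    simp only [map_add, LinearMap.sub_apply, LinearMap.neg_apply, LinearMap.lcomp_apply,
      LinearMap.add_apply, LinearMap.comp_apply]
    ring
  map_smul' c x := by
    ext f u
    simp only [map_smul, LinearMap.sub_apply, LinearMap.neg_apply, LinearMap.lcomp_apply,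
      LinearMap.smul_apply, LinearMap.comp_apply, smul_eq_mul, RingHom.id_apply]
    ring

theorem dualAction_even (M : GLModule n m U) {x : Gl n m} (hx : x ∈ glGr n m 0)
    (f : Module.Dual ℂ U) : M.dualAction x f = -(f ∘ₗ M.act x) := by
  ext u
  simp [dualAction, glProj_of_mem hx, glProj_of_mem_ne (show (0 : ZMod 2) ≠ 1 by decide) hx]

theorem dualAction_odd (M : GLModule n m U) {x : Gl n m} (hx : x ∈ glGr n m 1)
    (f : Module.Dual ℂ U) : M.dualAction x f = -(f ∘ₗ M.par ∘ₗ M.act x) := by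
  ext u
  simp [dualAction, glProj_of_mem hx, glProj_of_mem_ne (show (1 : ZMod 2) ≠ 0 by decide) hx]

theorem dualGr_par_even (M : GLModule n m U) {f : Module.Dual ℂ U} (hf : f ∈ M.dualGr 0) :
    f ∘ₗ M.par = f := by
  refine M.ext_hom fun i u hu => ?_
  rcases zmod_two_cases i with rfl | rfl
  · simp [M.par_even hu]
  · simp [M.par_odd hu, hf 1 (by decide) u hu]

theorem dualGr_par_odd (M : GLModule n m U) {f : Module.Dual ℂ U} (hf : f ∈ M.dualGr 1) :
    f ∘ₗ M.par = -f := by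
  refine M.ext_hom fun i u hu => ?_
  rcases zmod_two_cases i with rfl | rfl
  · simp [M.par_even hu, hf 0 (by decide) u hu]
  · simp [M.par_odd hu]

/-- The formula `(x f)(u) = -(-1)^{p(x)p(f)} f(x u)` for the dual action. -/
theorem dualAction_apply (M : GLModule n m U) {i j : ZMod 2} {x : Gl n m} (hx : x ∈ glGr n m i)
    {f : Module.Dual ℂ U} (hf : f ∈ M.dualGr j) (u : U) :
    M.dualAction x f u = -(sgn i j * f (M.act x u)) := by
  rcases zmod_two_cases i with rfl | rfl
  · simp [M.dualAction_even hx]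
  · rw [M.dualAction_odd hx, ← LinearMap.comp_assoc]
    rcases zmod_two_cases j with rfl | rfl
    · rw [M.dualGr_par_even hf]; simp
    · rw [M.dualGr_par_odd hf]; simp

/-- The dual module `U^*`. -/
def dual (M : GLModule n m U) : GLModule n m (Module.Dual ℂ U) where
  gr := M.dualGr
  isCompl := by
    have h01 : (0 : ZMod 2) ≠ 1 := by decide
    have h10 : (1 : ZMod 2) ≠ 0 := by decide
    constructor
    · rw [Submodule.disjoint_def]
      intro f h0 h1
      refine M.ext_hom fun i u hu => ?_
      rcases zmod_two_cases i with rfl | rfl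
      · exact h1 0 h01 u hu
      · exact h0 1 h10 u hu
    · rw [codisjoint_iff, eq_top_iff]
      intro f _
      have hf : f = (2 : ℂ)⁻¹ • (f + f ∘ₗ M.par) + (2 : ℂ)⁻¹ • (f - f ∘ₗ M.par) := by
        ext u
        simp only [LinearMap.add_apply, LinearMap.smul_apply, LinearMap.sub_apply, smul_eq_mul]
        ring
      rw [hf]
      refine Submodule.add_mem_sup ?_ ?_
      · intro j hj u hu
        rcases zmod_two_cases j with rfl | rfl
        · exact absurd rfl hj
        · simp [M.par_odd hu]
      · intro j hj u hu
        rcases zmod_two_cases j with rfl | rfl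
        · simp [M.par_even hu]
        · exact absurd rfl hj
  act := M.dualAction
  act_mem i j x hx f hf k hk u hu := by
    rw [M.dualAction_apply hx hf, hf (i + k) ?_ _ (M.act_mem i k x hx u hu)]
    · simp
    · intro h
      apply hk
      rw [← h]
      have h2 : ∀ a b : ZMod 2, b = a + (a + b) := by decide
      exact h2 i k
  act_sbracket i j x y hx hy := by
    have hxy := sbracket_mem_glGr hx hy
    have key := M.act_sbracket i j x y hx hy
    refine LinearMap.ext fun f => ?_
    rcases zmod_two_cases i with rfl | rfl <;> rcases zmod_two_cases j with rfl | rfl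
    · rw [zero_add] at hxy
      rw [M.dualAction_even hxy, key]
      ext u
      simp [sbracket, M.dualAction_even hx, M.dualAction_even hy]
    · rw [zero_add] at hxy
      rw [M.dualAction_odd hxy, key]
      ext u
      have h := LinearMap.congr_fun (M.par_act_even hx) (M.act y u)
      simp only [LinearMap.comp_apply] at h
      simp [sbracket, M.dualAction_even hx, M.dualAction_odd hy, h]
    · rw [add_zero] at hxy
      rw [M.dualAction_odd hxy, key]
      ext u
      have h := LinearMap.congr_fun (M.par_act_even hy) (M.act x u)
      simp only [LinearMap.comp_apply] at h
      simp [sbracket, M.dualAction_odd hx, M.dualAction_even hy, h]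
    · rw [show (1 : ZMod 2) + 1 = 0 by decide] at hxy
      rw [M.dualAction_even hxy, key]
      ext u
      have h1 := LinearMap.congr_fun (M.par_act_odd hy) (M.act x u)
      have h2 := LinearMap.congr_fun (M.par_act_odd hx) (M.act y u)
      have h3 := fun v => LinearMap.congr_fun M.par_par v
      simp only [LinearMap.comp_apply, LinearMap.neg_apply, LinearMap.id_apply] at h1 h2 h3
      have h4 : M.par (M.act y (M.par (M.act x u))) = -M.act y (M.act x u) := by
        have := LinearMap.congr_fun (M.par_act_odd hy) (M.par (M.act x u))
        simp only [LinearMap.comp_apply, LinearMap.neg_apply] at this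
        rw [this, h3]
      have h5 : M.par (M.act x (M.par (M.act y u))) = -M.act x (M.act y u) := by
        have := LinearMap.congr_fun (M.par_act_odd hx) (M.par (M.act y u))
        simp only [LinearMap.comp_apply, LinearMap.neg_apply] at this
        rw [this, h3]
      simp [sbracket, M.dualAction_odd hx, M.dualAction_odd hy, h4, h5]

/-- The extension of the action to `U(gl(n,2m))`. -/
def uact (M : GLModule n m U) : Ug n m →ₐ[ℂ] Module.End ℂ U := ugLift M.act M.act_sbracket

/-- The space of vectors `u` with `x u = 0` for all `x ∈ osp(n,2m)`. -/
def kInv (M : GLModule n m U) : Submodule ℂ U where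
  carrier := {u | ∀ x ∈ osp n m, M.act x u = 0}
  add_mem' hu hv x hx := by simp [hu x hx, hv x hx]
  zero_mem' := by simp
  smul_mem' c u hu x hx := by simp [hu x hx]

/-- The relation `exp(T) u = v` in a finite-dimensional space: `∑ Tᵏu / k!` converges to `v`,
tested coordinatewise, that is, on all linear functionals. -/
def ExpEq (T : Module.End ℂ U) (u v : U) : Prop :=
  ∀ f : Module.Dual ℂ U, HasSum (fun k : ℕ => ((k.factorial : ℂ))⁻¹ * f ((T ^ k) u)) (f v)

/-- The space of vectors killed by `osp(n,2m)` and, in addition, fixed by `O(n) ⊂ OSP(n,2m)`. The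
group `GL(n)` acts by `exp(X) u = ∑ Xᵏu / k!` for `X ∈ gl(n)`; as `exp` maps `gl(n)` onto `GL(n)`,
invariance under `O(n)` is invariance under all `exp(X)` with `exp(X) ∈ O(n)`. -/
def kInvO (M : GLModule n m U) : Submodule ℂ U where
  carrier := {u | u ∈ M.kInv ∧ ∀ X : Matrix (Fin n) (Fin n) ℂ,
    NormedSpace.exp X ∈ Matrix.orthogonalGroup (Fin n) ℂ →
      ExpEq (M.act (Matrix.fromBlocks X 0 0 0)) u u}
  add_mem' {u v} hu hv := by
    refine ⟨M.kInv.add_mem hu.1 hv.1, fun X hX f => ?_⟩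
    simpa [mul_add] using (hu.2 X hX f).add (hv.2 X hX f)
  zero_mem' := ⟨M.kInv.zero_mem, fun X _ f => by simp⟩
  smul_mem' c u hu := by
    refine ⟨M.kInv.smul_mem c hu.1, fun X hX f => ?_⟩
    simpa [mul_left_comm] using (hu.2 X hX f).mul_left c

/-- The matrix coefficient `φ_{u,l}(x) = l(x u)`. -/
def phi (M : GLModule n m U) (u : U) (l : Module.Dual ℂ U) : UgDual n m :=
  l ∘ₗ LinearMap.applyₗ u ∘ₗ M.uact.toLinearMap

/-- The linear space spanned by the functions `φ_{u,l}` with `u ∈ A`, `l ∈ B`; for `A = U^k` and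
`B = (U^*)^k` this is `Z(U)`. -/
def zonalSpace (M : GLModule n m U) (A : Submodule ℂ U) (B : Submodule ℂ (Module.Dual ℂ U)) :
    Submodule ℂ (UgDual n m) :=
  Submodule.span ℂ {f | ∃ u ∈ A, ∃ l ∈ B, f = M.phi u l}

end GLModule

end GLOsp

end

/-!
A nonzero matrix coefficient `w ↦ l(w v)` with `v` and `l` homogeneous determines an irreducible
module together with `v`. If `gl(n,2m)` is spanned by elements killing `l` and elements acting on
`v` by scalars, then such a coefficient is determined by those scalars and by `l(v)`. Applied to a
Borel subalgebra and its opposite, this shows that an irreducible module is determined by its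
highest weight and the parity of its highest weight vector, and it gives Schur's lemma.

(1) The involution `θ` maps `E_ij` to a multiple of `E_{s j, s i}`, where `s` exchanges the two
vectors of each symplectic pair. A highest weight vector of `U` for the standard ordering therefore
has weight `-(wt ∘ s)` in `U^θ` for the ordering reversed and twisted by `s`. The module `U^*` has
this highest weight for the same ordering: passing from an ordering to the one with an adjacent
symplectic pair exchanged is an even reflection, and the representation theory of the `sl₂` of the
pair shows that it exchanges the two entries of the highest weight.

(2) By the Iwasawa decomposition `gl(n,2m)` is the sum of `osp(n,2m)` and the Borel subalgebra, so
an invariant functional is determined by its value on the highest weight vector. By (1) the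
invariant vectors of `U` correspond to those of `U^*`.

(3) Invariant vectors are homogeneous by (2), and by Schur's lemma the centre acts by scalars.
-/

noncomputable section

namespace GLOsp

/-! ### Matrix units -/

/-- The matrix unit `E_ij` of `gl(n,2m)`. -/
abbrev matUnit {n m : ℕ} (i j : Idx n m) : Gl n m := Matrix.single i j 1

section Gl

variable {n m : ℕ}

theorem matUnit_mem (i j : Idx n m) : matUnit i j ∈ glGr n m (idxPar i + idxPar j) := by
  intro a b h
  refine Matrix.single_apply_of_ne _ _ _ _ _ ?_
  rintro ⟨rfl, rfl⟩
  exact h rfl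

theorem matUnit_mem_of_idxPar_eq {i j : Idx n m} (h : idxPar i = idxPar j) :
    matUnit i j ∈ glGr n m 0 := by
  simpa [h, CharTwo.add_self_eq_zero] using matUnit_mem i j

theorem diagonal_mem (d : Idx n m → ℂ) : Matrix.diagonal d ∈ glGr n m 0 := by
  intro a b h
  refine Matrix.diagonal_apply_ne _ ?_
  rintro rfl
  exact h (CharTwo.add_self_eq_zero _)

theorem matUnit_self (i : Idx n m) : matUnit i i = Matrix.diagonal (Pi.single i 1) :=
  (Matrix.diagonal_single i 1).symm

theorem eq_top_of_forall_matUnit_mem {S : Submodule ℂ (Gl n m)} (h : ∀ i j, matUnit i j ∈ S) :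
    S = ⊤ := by
  refine eq_top_iff.mpr fun x _ => ?_
  rw [Matrix.matrix_eq_sum_single x]
  refine S.sum_mem fun i _ => S.sum_mem fun j _ => ?_
  simpa using S.smul_mem (x i j) (h i j)

theorem sbracket_diagonal_matUnit (d : Idx n m → ℂ) (p : ZMod 2) (j k : Idx n m) :
    sbracket 0 p (Matrix.diagonal d) (matUnit j k) = (d j - d k) • matUnit j k := by
  rw [sbracket, sgn_zero_left, one_smul]
  ext a b
  by_cases h : j = a ∧ k = b
  · obtain ⟨rfl, rfl⟩ := h
    simp [mul_comm]
  · simp [Matrix.single_apply_of_ne _ _ _ _ _ h]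

theorem glProj_add (x : Gl n m) : glProj 0 x + glProj 1 x = x := by
  ext a b
  rcases zmod_two_cases (idxPar a + idxPar b) with h | h <;> simp [glProj, h]

end Gl

/-! ### The enveloping algebra -/

section Enveloping

variable {n m : ℕ}

@[elab_as_elim]
theorem ug_induction {P : Ug n m → Prop} (one : P 1) (smul : ∀ (c : ℂ) (w), P w → P (c • w))
    (add : ∀ a b, P a → P b → P (a + b))
    (ugι_mul : ∀ i, ∀ x ∈ glGr n m i, ∀ w, P w → P (ugι x * w)) (w : Ug n m) : P w := by
  obtain ⟨t, rfl⟩ : ∃ t, ugMk n m t = w := Quotient.exists_rep w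
  suffices h : ∀ w, P w → P (ugMk n m t * w) by simpa using h 1 one
  induction t using TensorAlgebra.induction with
  | algebraMap c =>
    intro w hw
    rw [AlgHom.commutes, ← Algebra.smul_def]
    exact smul c w hw
  | ι x =>
    intro w hw
    change P (ugι x * w)
    rw [← glProj_add x, map_add, add_mul]
    exact add _ _ (ugι_mul 0 _ (glProj_mem 0 x) w hw) (ugι_mul 1 _ (glProj_mem 1 x) w hw)
  | mul a b ha hb => exact fun w hw => by simpa [mul_assoc] using ha _ (hb _ hw)
  | add a b ha hb => exact fun w hw => by simpa [add_mul] using add _ _ (ha _ hw) (hb _ hw)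

theorem ugι_mul_ugι {i j : ZMod 2} {x y : Gl n m} (hx : x ∈ glGr n m i) (hy : y ∈ glGr n m j) :
    (ugι x * ugι y : Ug n m) = ugι (sbracket i j x y) + sgn i j • (ugι y * ugι x) := by
  rw [ugι_sbracket hx hy, sbracket, sub_add_cancel]

/-- A weak form of the Poincaré–Birkhoff–Witt factorization, for sets `A` and `B` whose spans need
not be subalgebras. -/
theorem eq_top_of_mul_mem {A B : Set (Gl n m)} (hA : ∀ a ∈ A, ∃ i, a ∈ glGr n m i)
    (hAB : Submodule.span ℂ (A ∪ B) = ⊤) {P : Submodule ℂ (Ug n m)} (one_mem : 1 ∈ P)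
    (mul_mem_left : ∀ a ∈ A, ∀ w ∈ P, ugι a * w ∈ P)
    (mul_mem_right : ∀ b ∈ B, ∀ w ∈ P, w * ugι b ∈ P) : P = ⊤ := by
  let C : Set (Submodule ℂ (Ug n m)) :=
    {S | 1 ∈ S ∧ (∀ a ∈ A, ∀ w ∈ S, ugι a * w ∈ S) ∧ ∀ b ∈ B, ∀ w ∈ S, w * ugι b ∈ S}
  have hC : sInf C ∈ C := by
    simp only [C, Set.mem_ofPred_eq, Submodule.mem_sInf]
    exact ⟨fun S hS => hS.1, fun a ha w hw S hS => hS.2.1 a ha w (hw S hS),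
      fun b hb w hw S hS => hS.2.2 b hb w (hw S hS)⟩
  obtain ⟨one_mem_S, left_S, right_S⟩ := hC
  -- The elements of the smallest member of `C` which all of `gl(n,2m)` multiplies into it form
  -- another member of `C`.
  let Q : Submodule ℂ (Ug n m) := sInf C ⊓ ⨅ x, (sInf C).comap (LinearMap.mulLeft ℂ (ugι x))
  have mem_Q : ∀ w, w ∈ Q ↔ w ∈ sInf C ∧ ∀ x, ugι x * w ∈ sInf C := fun w => by simp [Q]
  have hQ : Q ∈ C := by
    refine ⟨(mem_Q 1).mpr ⟨one_mem_S, fun x => ?_⟩, fun a ha w hw => ?_, fun b hb w hw => ?_⟩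
    · have hle : Submodule.span ℂ (A ∪ B) ≤ (sInf C).comap ugι := Submodule.span_le.mpr <| by
        rintro y (hy | hy)
        · simpa using left_S y hy 1 one_mem_S
        · simpa using right_S y hy 1 one_mem_S
      simpa using hle (hAB ▸ Submodule.mem_top : x ∈ _)
    · obtain ⟨j, ha'⟩ := hA a ha
      rw [mem_Q] at hw ⊢
      refine ⟨left_S a ha w hw.1, fun x => ?_⟩
      have homogeneous : ∀ i, ∀ y ∈ glGr n m i, ugι y * (ugι a * w) ∈ sInf C := fun i y hy => by
        rw [← mul_assoc, ugι_mul_ugι hy ha', add_mul, smul_mul_assoc, mul_assoc]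
        exact add_mem (hw.2 _) (Submodule.smul_mem _ _ (left_S a ha _ (hw.2 y)))
      rw [← glProj_add x, map_add, add_mul]
      exact add_mem (homogeneous 0 _ (glProj_mem 0 x)) (homogeneous 1 _ (glProj_mem 1 x))
    · rw [mem_Q] at hw ⊢
      exact ⟨right_S b hb w hw.1, fun x => mul_assoc (ugι x) w _ ▸ right_S b hb _ (hw.2 x)⟩
  refine eq_top_iff.mpr fun w _ => (sInf_le ⟨one_mem, mul_mem_left, mul_mem_right⟩ : sInf C ≤ P) ?_
  induction w using ug_induction with
  | one => exact one_mem_S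
  | smul c w hw => exact Submodule.smul_mem _ c (hw trivial)
  | add a b ha hb => exact add_mem (ha trivial) (hb trivial)
  | ugι_mul _ x _ w hw => exact ((mem_Q w).mp (sInf_le hQ (hw trivial))).2 x

theorem ugPar_ugι {i : ZMod 2} {x : Gl n m} (hx : x ∈ glGr n m i) :
    ugPar (ugι x) = sgn i 1 • ugι x := by
  rcases zmod_two_cases i with rfl | rfl
  · simp [ugPar_ugι_even hx]
  · simp [ugPar_ugι_odd hx]

theorem ugT_mul_ugι_even {y : Gl n m} (hy : y ∈ glGr n m 0) (w : Ug n m) :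
    ugT (w * ugι y) = -(ugι y * ugT w) := by
  induction w using ug_induction with
  | one => rw [one_mul, ugT_ugι, ugT_one, mul_one]
  | smul c w hw => simp_all [ugT]
  | add a b ha hb => simp_all [ugT, add_mul, mul_add, add_comm]
  | ugι_mul i x hx w hw =>
    rcases zmod_two_cases i with rfl | rfl
    · rw [mul_assoc, ugT_ugι_mul_even hx, hw, ugT_ugι_mul_even hx, neg_mul, mul_assoc]
    · rw [mul_assoc, ugT_ugι_mul_odd hx, hw, ugT_ugι_mul_odd hx, map_neg, map_mul,
        ugPar_ugι_even hy, neg_mul, mul_assoc]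

theorem ugT_mul_ugι_odd {y : Gl n m} (hy : y ∈ glGr n m 1) (w : Ug n m) :
    ugT (w * ugι y) = -(ugι y * ugPar (ugT w)) := by
  induction w using ug_induction with
  | one => rw [one_mul, ugT_ugι, ugT_one, map_one, mul_one]
  | smul c w hw => simp_all [ugT]
  | add a b ha hb => simp_all [ugT, add_mul, mul_add, add_comm]
  | ugι_mul i x hx w hw =>
    rcases zmod_two_cases i with rfl | rfl
    · rw [mul_assoc, ugT_ugι_mul_even hx, hw, ugT_ugι_mul_even hx, ugT_ugι, map_mul, map_neg,
        ugPar_ugι_even hx, neg_mul, mul_assoc]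
    · rw [mul_assoc, ugT_ugι_mul_odd hx, hw, ugT_ugι_mul_odd hx, ugT_ugι]
      simp [ugPar_ugι_odd hx, ugPar_ugι_odd hy, ugPar_ugPar, mul_assoc]

theorem mem_center_of_commute_ugι {z : Ug n m}
    (h : ∀ i, ∀ x ∈ glGr n m i, ugι x * z = z * ugι x) : z ∈ Subalgebra.center ℂ (Ug n m) := by
  rw [Subalgebra.mem_center_iff]
  intro w
  induction w using ug_induction with
  | one => rw [one_mul, mul_one]
  | smul c w hw => rw [smul_mul_assoc, hw, mul_smul_comm]
  | add a b ha hb => rw [add_mul, ha, hb, mul_add]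
  | ugι_mul i x hx w hw => rw [mul_assoc, hw, ← mul_assoc, h i x hx, mul_assoc]

theorem ugPar_mem_center {z : Ug n m} (hz : z ∈ Subalgebra.center ℂ (Ug n m)) :
    ugPar z ∈ Subalgebra.center ℂ (Ug n m) := by
  rw [Subalgebra.mem_center_iff] at hz ⊢
  intro w
  simpa [ugPar_ugPar] using congrArg ugPar (hz (ugPar w))

theorem ugComp_mem_center (i : ZMod 2) {z : Ug n m} (hz : z ∈ Subalgebra.center ℂ (Ug n m)) :
    ugComp i z ∈ Subalgebra.center ℂ (Ug n m) :=
  Subalgebra.smul_mem _ (add_mem hz (Subalgebra.smul_mem _ (ugPar_mem_center hz) _)) _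

theorem ugT_mem_center {z : Ug n m} (hz : z ∈ Subalgebra.center ℂ (Ug n m)) :
    ugT z ∈ Subalgebra.center ℂ (Ug n m) := by
  suffices h : ugPar (ugT z) ∈ Subalgebra.center ℂ (Ug n m) by
    simpa [ugPar_ugPar] using ugPar_mem_center h
  rw [Subalgebra.mem_center_iff] at hz
  refine mem_center_of_commute_ugι fun i x hx => ?_
  have h := congrArg ugT (hz (ugι x))
  rcases zmod_two_cases i with rfl | rfl
  · rw [ugT_ugι_mul_even hx, ugT_mul_ugι_even hx, ugT_ugι, mul_neg, neg_inj] at h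
    simpa [ugPar_ugι_even hx] using (congrArg ugPar h).symm
  · rw [ugT_ugι_mul_odd hx, ugT_mul_ugι_odd hx, ugT_ugι, mul_neg, neg_inj] at h
    exact h.symm

theorem exists_dualAct_eq_smul {f : UgDual n m} {ε : ℂ}
    (hpar : f ∘ₗ ugPar.toLinearMap = ε • f)
    (hcenter : ∀ z ∈ Subalgebra.center ℂ (Ug n m), ∃ c : ℂ, f ∘ₗ LinearMap.mulLeft ℂ z = c • f)
    {z : Ug n m} (hz : z ∈ Subalgebra.center ℂ (Ug n m)) : ∃ c : ℂ, dualAct z f = c • f := by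
  choose c hc using fun i => hcenter _ (ugT_mem_center (ugComp_mem_center i hz))
  refine ⟨∑ i, ∑ j, sgn i j * ((2 : ℂ)⁻¹ * (1 + sgn j 1 * ε)) * c i, ?_⟩
  have dualComp_eq : ∀ j, dualComp j f = ((2 : ℂ)⁻¹ * (1 + sgn j 1 * ε)) • f := fun j => by
    rw [dualComp, hpar]
    module
  simp only [dualAct, dualComp_eq, LinearMap.smul_comp, hc, smul_smul, Finset.sum_smul, mul_assoc]

end Enveloping

namespace GLModule

variable {n m : ℕ} {U : Type*} [AddCommGroup U] [Module ℂ U]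

/-! ### Modules and their matrix coefficients -/

theorem par_par_apply (M : GLModule n m U) (u : U) : M.par (M.par u) = u :=
  LinearMap.congr_fun M.par_par u

theorem half_add_par_mem (M : GLModule n m U) (u : U) : (2 : ℂ)⁻¹ • (u + M.par u) ∈ M.gr 0 := by
  have hu : u ∈ M.gr 0 ⊔ M.gr 1 := M.isCompl.sup_eq_top ▸ Submodule.mem_top
  obtain ⟨a, ha, b, hb, rfl⟩ := Submodule.mem_sup.mp hu
  rw [map_add, M.par_even ha, M.par_odd hb]
  convert ha using 1
  module

theorem half_sub_par_mem (M : GLModule n m U) (u : U) : (2 : ℂ)⁻¹ • (u - M.par u) ∈ M.gr 1 := by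
  have hu : u ∈ M.gr 0 ⊔ M.gr 1 := M.isCompl.sup_eq_top ▸ Submodule.mem_top
  obtain ⟨a, ha, b, hb, rfl⟩ := Submodule.mem_sup.mp hu
  rw [map_add, M.par_even ha, M.par_odd hb]
  convert hb using 1
  module

theorem mem_gr_iff_par (M : GLModule n m U) {i : ZMod 2} {u : U} :
    u ∈ M.gr i ↔ M.par u = sgn i 1 • u := by
  rcases zmod_two_cases i with rfl | rfl
  · refine ⟨fun h => by simp [M.par_even h], fun h => ?_⟩
    convert M.half_add_par_mem u using 1
    rw [h, sgn_zero_left]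
    module
  · refine ⟨fun h => by simp [M.par_odd h], fun h => ?_⟩
    convert M.half_sub_par_mem u using 1
    rw [h, sgn_one_one]
    module

theorem exists_mem_gr_of_par_eq_smul (M : GLModule n m U) {u : U} {c : ℂ} (hu : M.par u = c • u) :
    ∃ i, u ∈ M.gr i := by
  rcases eq_or_ne u 0 with rfl | hu0
  · exact ⟨0, zero_mem _⟩
  have hc : (c * c - 1) • u = 0 := by
    rw [sub_smul, mul_smul, ← hu, ← map_smul, ← hu, par_par_apply, one_smul, sub_self]
  have hc' : c * c = 1 := sub_eq_zero.mp ((smul_eq_zero.mp hc).resolve_right hu0)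
  rcases mul_self_eq_one_iff.mp hc' with rfl | rfl
  · exact ⟨0, M.mem_gr_iff_par.mpr (by rw [hu, sgn_zero_left])⟩
  · exact ⟨1, M.mem_gr_iff_par.mpr (by rw [hu, sgn_one_one])⟩

theorem par_act (M : GLModule n m U) {i : ZMod 2} {x : Gl n m} (hx : x ∈ glGr n m i) (u : U) :
    M.par (M.act x u) = sgn i 1 • M.act x (M.par u) := by
  rcases zmod_two_cases i with rfl | rfl
  · simpa using LinearMap.congr_fun (M.par_act_even hx) u
  · simpa using LinearMap.congr_fun (M.par_act_odd hx) u

theorem act_act (M : GLModule n m U) {i j : ZMod 2} {x y : Gl n m} (hx : x ∈ glGr n m i)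
    (hy : y ∈ glGr n m j) (u : U) :
    M.act x (M.act y u) = M.act (sbracket i j x y) u + sgn i j • M.act y (M.act x u) := by
  rw [M.act_sbracket i j x y hx hy]
  simp [sbracket]

theorem act_diagonal_act_matUnit (M : GLModule n m U) (d : Idx n m → ℂ) (j k : Idx n m) (u : U) :
    M.act (Matrix.diagonal d) (M.act (matUnit j k) u) =
      M.act (matUnit j k) (M.act (Matrix.diagonal d) u) + (d j - d k) • M.act (matUnit j k) u := by
  rw [M.act_act (diagonal_mem d) (matUnit_mem j k), sbracket_diagonal_matUnit, map_smul,
    LinearMap.smul_apply, sgn_zero_left, one_smul, add_comm]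

theorem uact_ugι (M : GLModule n m U) (x : Gl n m) : M.uact (ugι x) = M.act x :=
  ugLift_ugι _ _ x

theorem uact_ugPar (M : GLModule n m U) (w : Ug n m) (u : U) :
    M.uact (ugPar w) (M.par u) = M.par (M.uact w u) := by
  induction w using ug_induction generalizing u with
  | one => simp
  | smul c w hw => simp [hw]
  | add a b ha hb => simp [ha, hb]
  | ugι_mul i x hx w hw =>
    simp [ugPar_ugι hx, uact_ugι, hw, M.par_act hx]

theorem par_uact (M : GLModule n m U) {p : ZMod 2} {v : U} (hv : v ∈ M.gr p) (w : Ug n m) :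
    M.par (M.uact w v) = sgn p 1 • M.uact (ugPar w) v := by
  rw [← uact_ugPar, M.mem_gr_iff_par.mp hv, map_smul]

/-- The map `w ↦ w v` from the enveloping algebra to a module; composing it with a functional gives
a matrix coefficient. -/
def orbitMap (M : GLModule n m U) (v : U) : Ug n m →ₗ[ℂ] U :=
  LinearMap.applyₗ v ∘ₗ M.uact.toLinearMap

@[simp] theorem orbitMap_apply (M : GLModule n m U) (v : U) (w : Ug n m) :
    M.orbitMap v w = M.uact w v := rfl

@[simp] theorem phi_apply (M : GLModule n m U) (v : U) (l : Module.Dual ℂ U) (w : Ug n m) :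
    M.phi v l w = l (M.uact w v) := rfl

theorem IsIrreducible.eq_bot_or_eq_top {M : GLModule n m U} (hM : M.IsIrreducible)
    {W : Submodule ℂ U} (hW : ∀ x, ∀ u ∈ W, M.act x u ∈ W) (hpar : ∀ u ∈ W, M.par u ∈ W) :
    W = ⊥ ∨ W = ⊤ := by
  refine hM.2 W (fun u hu => ?_) hW
  have hsplit : u = (2 : ℂ)⁻¹ • (u + M.par u) + (2 : ℂ)⁻¹ • (u - M.par u) := by module
  rw [hsplit]
  exact Submodule.add_mem_sup
    ⟨W.smul_mem _ (W.add_mem hu (hpar u hu)), M.half_add_par_mem u⟩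
    ⟨W.smul_mem _ (W.sub_mem hu (hpar u hu)), M.half_sub_par_mem u⟩

theorem IsIrreducible.orbitMap_surjective {M : GLModule n m U} (hM : M.IsIrreducible)
    {p : ZMod 2} {v : U} (hv : v ∈ M.gr p) (hv0 : v ≠ 0) : Function.Surjective (M.orbitMap v) := by
  rw [← LinearMap.range_eq_top]
  refine (hM.eq_bot_or_eq_top ?_ ?_).resolve_left fun h => hv0 ?_
  · rintro x _ ⟨w, rfl⟩
    exact ⟨ugι x * w, by simp [uact_ugι]⟩
  · rintro _ ⟨w, rfl⟩
    exact ⟨sgn p 1 • ugPar w, by simp [M.par_uact hv]⟩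
  · simpa using (Submodule.eq_bot_iff _).mp h _ ⟨1, rfl⟩

theorem IsIrreducible.phi_ne_zero {M : GLModule n m U} (hM : M.IsIrreducible) {p : ZMod 2} {v : U}
    (hv : v ∈ M.gr p) (hv0 : v ≠ 0) {l : Module.Dual ℂ U} (hl0 : l ≠ 0) : M.phi v l ≠ 0 := by
  refine fun h => hl0 (LinearMap.ext fun u => ?_)
  obtain ⟨w, rfl⟩ := hM.orbitMap_surjective hv hv0 u
  exact LinearMap.congr_fun h w

theorem dual_par_apply (M : GLModule n m U) (l : Module.Dual ℂ U) (u : U) :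
    M.dual.par l u = l (M.par u) := by
  suffices h : M.dual.par = M.par.dualMap by rw [h]; rfl
  refine M.dual.ext_hom fun i l hl => ?_
  rcases zmod_two_cases i with rfl | rfl
  · rw [M.dual.par_even hl]
    exact (M.dualGr_par_even hl).symm
  · rw [M.dual.par_odd hl]
    exact (M.dualGr_par_odd hl).symm

theorem apply_par (M : GLModule n m U) {q : ZMod 2} {l : Module.Dual ℂ U} (hl : l ∈ M.dual.gr q)
    (u : U) : l (M.par u) = sgn q 1 * l u := by
  rw [← dual_par_apply, M.dual.mem_gr_iff_par.mp hl, LinearMap.smul_apply, smul_eq_mul]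

theorem phi_ugPar (M : GLModule n m U) {p q : ZMod 2} {v : U} (hv : v ∈ M.gr p)
    {l : Module.Dual ℂ U} (hl : l ∈ M.dual.gr q) :
    M.phi v l ∘ₗ ugPar.toLinearMap = (sgn q 1 * sgn p 1) • M.phi v l := by
  ext w
  simp only [LinearMap.comp_apply, AlgHom.toLinearMap_apply, phi_apply, LinearMap.smul_apply]
  rw [← M.par_par_apply (M.uact (ugPar w) v), M.apply_par hl, M.par_uact hv, ugPar_ugPar, map_smul,
    smul_eq_mul, smul_eq_mul, mul_assoc]

theorem IsIrreducible.eq_zero_of_phi_eq_zero {M : GLModule n m U} (hM : M.IsIrreducible)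
    {q : ZMod 2} {l : Module.Dual ℂ U} (hl : l ∈ M.dual.gr q) (hl0 : l ≠ 0) {u : U}
    (hu : M.phi u l = 0) : u = 0 := by
  let W : Submodule ℂ U := ⨅ w, LinearMap.ker (l ∘ₗ M.uact w)
  have mem_W : ∀ u, u ∈ W ↔ ∀ w, l (M.uact w u) = 0 := fun u => by simp [W]
  have huW : u ∈ W := (mem_W u).mpr (LinearMap.congr_fun hu)
  have act_mem_W : ∀ x, ∀ u ∈ W, M.act x u ∈ W := fun x u hu => by
    rw [mem_W] at hu ⊢
    exact fun w => by simpa [uact_ugι] using hu (w * ugι x)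
  have par_mem_W : ∀ u ∈ W, M.par u ∈ W := fun u hu => by
    rw [mem_W] at hu ⊢
    intro w
    rw [← ugPar_ugPar w, uact_ugPar, M.apply_par hl, hu, mul_zero]
  have W_ne_top : W ≠ ⊤ := fun h => hl0 <| LinearMap.ext fun u => by
    simpa using (mem_W u).mp (h ▸ Submodule.mem_top) 1
  simpa [(hM.eq_bot_or_eq_top act_mem_W par_mem_W).resolve_right W_ne_top] using huW

/-- Both modules are the quotient of the enveloping algebra by the largest left ideal in the kernel
of the matrix coefficient. -/
theorem isIsomorphic_of_phi_eq {U' : Type*} [AddCommGroup U'] [Module ℂ U'] {M : GLModule n m U}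
    {M' : GLModule n m U'} (hM : M.IsIrreducible) (hM' : M'.IsIrreducible) {p q q' : ZMod 2}
    {v : U} {v' : U'} (hv : v ∈ M.gr p) (hv' : v' ∈ M'.gr p) (hv0 : v ≠ 0) (hv0' : v' ≠ 0)
    {l : Module.Dual ℂ U} {l' : Module.Dual ℂ U'} (hl : l ∈ M.dual.gr q) (hl' : l' ∈ M'.dual.gr q')
    (hl0 : l ≠ 0) (hl0' : l' ≠ 0) (h : M.phi v l = M'.phi v' l') : M.IsIsomorphic M' := by
  have phi_orbitMap : ∀ w, M.phi (M.orbitMap v w) l = M'.phi (M'.orbitMap v' w) l' := fun w => by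
    ext y
    simpa using LinearMap.congr_fun h (y * w)
  have ker_eq : LinearMap.ker (M.orbitMap v) = LinearMap.ker (M'.orbitMap v') := by
    ext w
    simp only [LinearMap.mem_ker]
    refine ⟨fun hw => hM'.eq_zero_of_phi_eq_zero hl' hl0' ?_,
      fun hw => hM.eq_zero_of_phi_eq_zero hl hl0 ?_⟩
    · rw [← phi_orbitMap, hw]
      ext; simp
    · rw [phi_orbitMap, hw]
      ext; simp
  let e : U ≃ₗ[ℂ] U' :=
    ((M.orbitMap v).quotKerEquivOfSurjective (hM.orbitMap_surjective hv hv0)).symm ≪≫ₗ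
      Submodule.quotEquivOfEq _ _ ker_eq ≪≫ₗ
      (M'.orbitMap v').quotKerEquivOfSurjective (hM'.orbitMap_surjective hv' hv0')
  have e_uact : ∀ w, e (M.uact w v) = M'.uact w v' := fun w => by
    have h : (M.orbitMap v).quotKerEquivOfSurjective (hM.orbitMap_surjective hv hv0)
        (Submodule.Quotient.mk w) = M.uact w v := rfl
    simp only [e, LinearEquiv.trans_apply, ← h, LinearEquiv.symm_apply_apply]
    rfl
  refine ⟨e, fun i u hu => ?_, fun x u => ?_⟩ <;>
    obtain ⟨w, rfl⟩ := hM.orbitMap_surjective hv hv0 u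
  · rw [mem_gr_iff_par] at hu ⊢
    rw [← map_smul, ← hu, orbitMap_apply, e_uact, M.par_uact hv, M'.par_uact hv', map_smul, e_uact]
  · simpa [uact_ugι, e_uact] using e_uact (ugι x * w)

/-! ### Twisted and dual modules -/

theorem IsIrreducible.twist {M : GLModule n m U} (hM : M.IsIrreducible) :
    M.twist.IsIrreducible := by
  refine ⟨hM.1, fun W hW hact => hM.2 W hW fun x u hu => ?_⟩
  have h : M.act (theta (theta x)) u ∈ W := hact (theta x) u hu
  rwa [theta_theta] at h

theorem dual_act_of_even (M : GLModule n m U) {x : Gl n m} (hx : x ∈ glGr n m 0)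
    (l : Module.Dual ℂ U) (u : U) : M.dual.act x l u = -l (M.act x u) :=
  LinearMap.congr_fun (M.dualAction_even hx l) u

theorem dual_act_of_odd (M : GLModule n m U) {x : Gl n m} (hx : x ∈ glGr n m 1)
    (l : Module.Dual ℂ U) (u : U) : M.dual.act x l u = -l (M.par (M.act x u)) :=
  LinearMap.congr_fun (M.dualAction_odd hx l) u

theorem apply_act (M : GLModule n m U) (l : Module.Dual ℂ U) (x : Gl n m) (u : U) :
    l (M.act x u) = M.dual.act (glProj 1 x) l (M.par u) - M.dual.act (glProj 0 x) l u := by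
  rw [M.dual_act_of_even (glProj_mem 0 x), M.dual_act_of_odd (glProj_mem 1 x),
    M.par_act (glProj_mem 1 x), par_par_apply]
  nth_rw 1 [← glProj_add x]
  simp [add_comm]

theorem par_mem_of_le_sup (M : GLModule n m U) {W : Submodule ℂ U}
    (hW : W ≤ (W ⊓ M.gr 0) ⊔ (W ⊓ M.gr 1)) {u : U} (hu : u ∈ W) : M.par u ∈ W := by
  obtain ⟨a, ha, b, hb, rfl⟩ := Submodule.mem_sup.mp (hW hu)
  rw [map_add, M.par_even ha.2, M.par_odd hb.2]
  exact W.add_mem ha.1 (W.neg_mem hb.1)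

theorem IsIrreducible.dual [FiniteDimensional ℂ U] {M : GLModule n m U} (hM : M.IsIrreducible) :
    M.dual.IsIrreducible := by
  have := hM.1
  refine ⟨inferInstance, fun W hW hact => ?_⟩
  have par_mem : ∀ u ∈ W.dualCoannihilator, M.par u ∈ W.dualCoannihilator := fun u hu => by
    rw [Submodule.mem_dualCoannihilator] at hu ⊢
    intro l hl
    rw [← dual_par_apply]
    exact hu _ (M.dual.par_mem_of_le_sup hW hl)
  have act_mem : ∀ x, ∀ u ∈ W.dualCoannihilator, M.act x u ∈ W.dualCoannihilator := by
    intro x u hu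
    have hpar := par_mem u hu
    rw [Submodule.mem_dualCoannihilator] at hu hpar ⊢
    intro l hl
    rw [M.apply_act, hu _ (hact _ l hl), hpar _ (hact _ l hl), sub_zero]
  rw [← Subspace.dualCoannihilator_dualAnnihilator_eq (W := W)]
  rcases hM.eq_bot_or_eq_top act_mem par_mem with h | h <;> simp [h]

end GLModule

/-! ### Highest weight vectors -/

theorem exists_common_eigenvector {K V ι : Type*} [Field K] [IsAlgClosed K] [AddCommGroup V]
    [Module K V] [FiniteDimensional K V] {T : ι → Module.End K V}
    (hT : ∀ i j, Commute (T i) (T j)) {W : Submodule K V} (hW : W ≠ ⊥)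
    (hTW : ∀ i, ∀ w ∈ W, T i w ∈ W) : ∃ v ∈ W, v ≠ 0 ∧ ∀ i, ∃ c : K, T i v = c • v := by
  induction hd : Module.finrank K W using Nat.strong_induction_on generalizing W with
  | _ d ih =>
  by_cases hscalar : ∀ i, ∃ c : K, ∀ w ∈ W, T i w = c • w
  · obtain ⟨v, hv, hv0⟩ := W.ne_bot_iff.mp hW
    exact ⟨v, hv, hv0, fun i => (hscalar i).imp fun c hc => hc v hv⟩
  push Not at hscalar
  obtain ⟨i, hi⟩ := hscalar
  have := Submodule.nontrivial_iff_ne_bot.mpr hW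
  obtain ⟨c, hc⟩ := Module.End.exists_eigenvalue ((T i).restrict (hTW i))
  obtain ⟨w, hw⟩ := hc.exists_hasEigenvector
  have hw' : T i w = c • (w : V) := congrArg Subtype.val hw.apply_eq_smul
  obtain ⟨u, hu, hu'⟩ := hi c
  have hlt : W ⊓ (T i).eigenspace c < W :=
    inf_lt_left.mpr fun hle => hu' (Module.End.mem_eigenspace_iff.mp (hle hu))
  obtain ⟨v, hv, hv'⟩ := ih _ (hd ▸ Submodule.finrank_lt_finrank_of_lt hlt)
    (W := W ⊓ (T i).eigenspace c)
    ((Submodule.ne_bot_iff _).mpr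
      ⟨w, ⟨w.2, Module.End.mem_eigenspace_iff.mpr hw'⟩, fun h => hw.2 (Subtype.ext h)⟩)
    (fun j x hx => ⟨hTW j x hx.1, Module.End.mapsTo_genEigenspace_of_comm (hT i j) c 1 hx.2⟩) rfl
  exact ⟨v, hv.1, hv'⟩

namespace GLModule

variable {n m : ℕ} {U : Type*} [AddCommGroup U] [Module ℂ U]

/-- The highest weight vectors, together with `0`, of weight `wt` with respect to the ordering of
the standard basis of `V` by increasing `r`: they are killed by the `E_ij` with `r i < r j`. -/
def hwSpace (M : GLModule n m U) (r : Idx n m → ℤ) (wt : Idx n m → ℂ) : Submodule ℂ U where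
  carrier := {v | (∀ i j, r i < r j → M.act (matUnit i j) v = 0) ∧
    ∀ i, M.act (matUnit i i) v = wt i • v}
  add_mem' hu hv :=
    ⟨fun i j h => by simp [hu.1 i j h, hv.1 i j h], fun i => by simp [hu.2 i, hv.2 i]⟩
  zero_mem' := by simp
  smul_mem' c v hv :=
    ⟨fun i j h => by simp [hv.1 i j h], fun i => by simp [hv.2 i, smul_comm c]⟩

/-- A nonzero highest weight vector of parity `p`. -/
structure IsHighestWeightVector (M : GLModule n m U) (r : Idx n m → ℤ) (wt : Idx n m → ℂ)
    (p : ZMod 2) (v : U) : Prop where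
  mem_hwSpace : v ∈ M.hwSpace r wt
  mem_gr : v ∈ M.gr p
  ne_zero : v ≠ 0

theorem act_matUnit_of_le {M : GLModule n m U} {r : Idx n m → ℤ} (hr : Function.Injective r)
    {wt : Idx n m → ℂ} {v : U} (hv : v ∈ M.hwSpace r wt) {i j : Idx n m} (hij : r i ≤ r j) :
    M.act (matUnit i j) v = (if i = j then wt i else 0) • v := by
  rcases hij.lt_or_eq with hlt | heq
  · rw [hv.1 i j hlt, if_neg (by rintro rfl; exact hlt.ne rfl), zero_smul]
  · rw [← hr heq, hv.2 i, if_pos rfl]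

theorem IsHighestWeightVector.smul {M : GLModule n m U} {r : Idx n m → ℤ} {wt : Idx n m → ℂ}
    {p : ZMod 2} {v : U} (hv : M.IsHighestWeightVector r wt p v) {c : ℂ} (hc : c ≠ 0) :
    M.IsHighestWeightVector r wt p (c • v) :=
  ⟨Submodule.smul_mem _ c hv.1, Submodule.smul_mem _ c hv.2, smul_ne_zero hc hv.3⟩

/-- For `H = diag(-r)`, the operator `E_ij` shifts the eigenvalues of `H` by `r j - r i`, hence it
kills an eigenspace with eigenvalue of maximal real part if `r i < r j`. -/
theorem exists_eigenspace_le_ker_act_matUnit [FiniteDimensional ℂ U] [Nontrivial U]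
    (M : GLModule n m U) (r : Idx n m → ℤ) :
    ∃ c, (M.act (Matrix.diagonal fun i => -(r i : ℂ))).HasEigenvalue c ∧
      ∀ i j, r i < r j → ∀ u ∈ (M.act (Matrix.diagonal fun i => -(r i : ℂ))).eigenspace c,
        M.act (matUnit i j) u = 0 := by
  set H := M.act (Matrix.diagonal fun i => -(r i : ℂ))
  obtain ⟨c₀, hc₀⟩ := Module.End.exists_eigenvalue H
  obtain ⟨c, hc, hmax⟩ := Set.exists_max_image _ Complex.re (Module.End.finite_hasEigenvalue H)
    ⟨c₀, hc₀⟩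
  refine ⟨c, hc, fun i j hij u hu => ?_⟩
  by_contra hne
  rw [Module.End.mem_eigenspace_iff] at hu
  have shifted : H.HasEigenvalue (c + ((r j : ℂ) - r i)) := by
    refine Module.End.hasEigenvalue_of_hasEigenvector (x := M.act (matUnit i j) u) ⟨?_, hne⟩
    rw [Module.End.mem_eigenspace_iff, act_diagonal_act_matUnit, hu, map_smul]
    module
  have hle : c.re + ((r j : ℝ) - r i) ≤ c.re := by simpa using hmax _ shifted
  have hlt : (r i : ℝ) < r j := by exact_mod_cast hij
  linarith

theorem commute_par_act {M : GLModule n m U} {x : Gl n m} (hx : x ∈ glGr n m 0) :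
    Commute M.par (M.act x) :=
  M.par_act_even hx

theorem commute_act_diagonal (M : GLModule n m U) (d d' : Idx n m → ℂ) :
    Commute (M.act (Matrix.diagonal d)) (M.act (Matrix.diagonal d')) := by
  refine LinearMap.ext fun u => ?_
  have h := M.act_act (diagonal_mem d) (diagonal_mem d') u
  simpa [sbracket, mul_comm] using h

theorem exists_isHighestWeightVector [FiniteDimensional ℂ U] [Nontrivial U] (M : GLModule n m U)
    (r : Idx n m → ℤ) : ∃ wt p v, M.IsHighestWeightVector r wt p v := by
  obtain ⟨c, hc, hkill⟩ := M.exists_eigenspace_le_ker_act_matUnit r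
  set H := M.act (Matrix.diagonal fun i => -(r i : ℂ))
  let T : Option (Idx n m) → Module.End ℂ U :=
    fun o => o.elim M.par fun i => M.act (Matrix.diagonal (Pi.single i 1))
  have commute_T : ∀ o o', Commute (T o) (T o') := by
    rintro (_ | i) (_ | j)
    · exact Commute.refl _
    · exact commute_par_act (diagonal_mem _)
    · exact (commute_par_act (diagonal_mem _)).symm
    · exact M.commute_act_diagonal _ _
  have commute_H : ∀ o, Commute H (T o) := by
    rintro (_ | i)
    · exact (commute_par_act (diagonal_mem _)).symm
    · exact M.commute_act_diagonal _ _
  obtain ⟨v, hv, hv0, hT⟩ := exists_common_eigenvector commute_T hc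
    fun o u hu => Module.End.mapsTo_genEigenspace_of_comm (commute_H o) c 1 hu
  obtain ⟨ε, hε⟩ := hT none
  obtain ⟨p, hp⟩ := M.exists_mem_gr_of_par_eq_smul hε
  choose wt hwt using fun i => hT (some i)
  exact ⟨wt, p, v, ⟨fun i j hij => hkill i j hij v hv, fun i => matUnit_self i ▸ hwt i⟩, hp, hv0⟩

theorem phi_eq_phi {U' : Type*} [AddCommGroup U'] [Module ℂ U'] {M : GLModule n m U}
    {M' : GLModule n m U'} {A B : Set (Gl n m)} (hA : ∀ a ∈ A, ∃ i, a ∈ glGr n m i)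
    (hAB : Submodule.span ℂ (A ∪ B) = ⊤) {l : Module.Dual ℂ U} {l' : Module.Dual ℂ U'}
    (hl : ∀ a ∈ A, ∀ u, l (M.act a u) = 0) (hl' : ∀ a ∈ A, ∀ u, l' (M'.act a u) = 0)
    {v : U} {v' : U'} (hB : ∀ b ∈ B, ∃ c : ℂ, M.act b v = c • v ∧ M'.act b v' = c • v')
    (h : l v = l' v') : M.phi v l = M'.phi v' l' := by
  refine LinearMap.eqLocus_eq_top.mp (eq_top_of_mul_mem hA hAB ?_ ?_ ?_)
  · simpa [LinearMap.mem_eqLocus]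
  · intro a ha w _
    simp [LinearMap.mem_eqLocus, uact_ugι, hl a ha, hl' a ha]
  · intro b hb w hw
    obtain ⟨c, hc, hc'⟩ := hB b hb
    simp_all [LinearMap.mem_eqLocus, uact_ugι]

theorem apply_act_eq_zero {M : GLModule n m U} {i : ZMod 2} {x : Gl n m} (hx : x ∈ glGr n m i)
    {l : Module.Dual ℂ U} (hl : M.dual.act x l = 0) (u : U) : l (M.act x u) = 0 := by
  rw [M.apply_act]
  rcases zmod_two_cases i with rfl | rfl
  · simp [glProj_of_mem hx, glProj_of_mem_ne zero_ne_one hx, hl]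
  · simp [glProj_of_mem hx, glProj_of_mem_ne one_ne_zero hx, hl]

theorem phi_eq_phi_of_mem_hwSpace {U' : Type*} [AddCommGroup U'] [Module ℂ U']
    {M : GLModule n m U} {M' : GLModule n m U'} {r : Idx n m → ℤ} (hr : Function.Injective r)
    {wt wt₁ wt₁' : Idx n m → ℂ} {v : U} {v' : U'} (hv : v ∈ M.hwSpace r wt)
    (hv' : v' ∈ M'.hwSpace r wt) {l : Module.Dual ℂ U} {l' : Module.Dual ℂ U'}
    (hl : l ∈ M.dual.hwSpace (-r) wt₁) (hl' : l' ∈ M'.dual.hwSpace (-r) wt₁')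
    (h : l v = l' v') : M.phi v l = M'.phi v' l' := by
  refine phi_eq_phi (A := {x | ∃ i j, r j < r i ∧ x = matUnit i j})
    (B := {x | ∃ i j, r i ≤ r j ∧ x = matUnit i j}) ?_ ?_ ?_ ?_ ?_ h
  · rintro _ ⟨i, j, -, rfl⟩
    exact ⟨_, matUnit_mem i j⟩
  · refine eq_top_of_forall_matUnit_mem fun i j => Submodule.subset_span ?_
    exact (lt_or_ge (r j) (r i)).imp (fun hij => ⟨i, j, hij, rfl⟩) fun hij => ⟨i, j, hij, rfl⟩
  · rintro _ ⟨i, j, hij, rfl⟩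
    exact apply_act_eq_zero (matUnit_mem i j) (hl.1 i j (neg_lt_neg hij))
  · rintro _ ⟨i, j, hij, rfl⟩
    exact apply_act_eq_zero (matUnit_mem i j) (hl'.1 i j (neg_lt_neg hij))
  · rintro _ ⟨i, j, hij, rfl⟩
    exact ⟨_, act_matUnit_of_le hr hv hij, act_matUnit_of_le hr hv' hij⟩

theorem IsHighestWeightVector.exists_dual [FiniteDimensional ℂ U] {M : GLModule n m U}
    (hM : M.IsIrreducible) {r : Idx n m → ℤ} (hr : Function.Injective r) {wt : Idx n m → ℂ}
    {p : ZMod 2} {v : U} (hv : M.IsHighestWeightVector r wt p v) :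
    ∃ l, M.dual.IsHighestWeightVector (-r) (-wt) p l ∧ l v = 1 := by
  have := hM.1
  obtain ⟨wt', q, l, hl⟩ := M.dual.exists_isHighestWeightVector (-r)
  have hlv : l v ≠ 0 := fun h => hM.phi_ne_zero hv.mem_gr hv.ne_zero hl.ne_zero <| by
    rw [phi_eq_phi_of_mem_hwSpace hr hv.mem_hwSpace hv.mem_hwSpace hl.mem_hwSpace
      (zero_mem (M.dual.hwSpace (-r) wt')) (by simpa using h)]
    rfl
  obtain rfl : p = q := by_contra fun hpq => hlv (hl.mem_gr p hpq v hv.mem_gr)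
  obtain rfl : wt' = -wt := funext fun i => by
    have h := M.dual_act_of_even (matUnit_mem_of_idxPar_eq (rfl : idxPar i = idxPar i)) l v
    rw [hl.mem_hwSpace.2 i, hv.mem_hwSpace.2 i] at h
    exact mul_right_cancel₀ hlv (by simpa using h)
  exact ⟨(l v)⁻¹ • l, hl.smul (inv_ne_zero hlv), by simp [hlv]⟩

theorem IsHighestWeightVector.exists_eq_smul [FiniteDimensional ℂ U] {M : GLModule n m U}
    (hM : M.IsIrreducible) {r : Idx n m → ℤ} (hr : Function.Injective r) {wt : Idx n m → ℂ}
    {p : ZMod 2} {v : U} (hv : M.IsHighestWeightVector r wt p v) {w : U}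
    (hw : w ∈ M.hwSpace r wt) : ∃ c : ℂ, w = c • v := by
  obtain ⟨l, hl, hlv⟩ := hv.exists_dual hM hr
  refine ⟨l w, sub_eq_zero.mp (hM.eq_zero_of_phi_eq_zero hl.mem_gr hl.ne_zero ?_)⟩
  rw [phi_eq_phi_of_mem_hwSpace hr (sub_mem hw (Submodule.smul_mem _ (l w) hv.mem_hwSpace))
    (zero_mem (M.hwSpace r wt)) hl.mem_hwSpace hl.mem_hwSpace (by simp [hlv])]
  ext
  simp

theorem IsHighestWeightVector.isIsomorphic {U' : Type*} [AddCommGroup U'] [Module ℂ U']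
    [FiniteDimensional ℂ U] [FiniteDimensional ℂ U'] {M : GLModule n m U} {M' : GLModule n m U'}
    (hM : M.IsIrreducible) (hM' : M'.IsIrreducible) {r : Idx n m → ℤ} (hr : Function.Injective r)
    {wt : Idx n m → ℂ} {p : ZMod 2} {v : U} {v' : U'} (hv : M.IsHighestWeightVector r wt p v)
    (hv' : M'.IsHighestWeightVector r wt p v') : M.IsIsomorphic M' := by
  obtain ⟨l, hl, hlv⟩ := hv.exists_dual hM hr
  obtain ⟨l', hl', hlv'⟩ := hv'.exists_dual hM' hr
  exact isIsomorphic_of_phi_eq hM hM' hv.mem_gr hv'.mem_gr hv.ne_zero hv'.ne_zero hl.mem_gr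
    hl'.mem_gr hl.ne_zero hl'.ne_zero (phi_eq_phi_of_mem_hwSpace hr hv.mem_hwSpace
      hv'.mem_hwSpace hl.mem_hwSpace hl'.mem_hwSpace (hlv.trans hlv'.symm))

theorem commute_uact {M : GLModule n m U} {T : Module.End ℂ U} (hT : ∀ x, Commute T (M.act x))
    (w : Ug n m) : Commute T (M.uact w) := by
  induction w using ug_induction with
  | one => simp
  | smul c w hw => simpa using hw.smul_right c
  | add a b ha hb => simpa using ha.add_right hb
  | ugι_mul _ x _ w hw => simpa [uact_ugι] using (hT x).mul_right hw

/-- Schur's lemma for endomorphisms which need not preserve parity. -/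
theorem IsIrreducible.exists_eq_smul_of_commute [FiniteDimensional ℂ U] {M : GLModule n m U}
    (hM : M.IsIrreducible) {T : Module.End ℂ U} (hT : ∀ x, Commute T (M.act x)) :
    ∃ c : ℂ, T = c • 1 := by
  have := hM.1
  obtain ⟨r, hr⟩ := exists_injective_nat (Idx n m)
  have hr' : Function.Injective fun i => (r i : ℤ) := Nat.cast_injective.comp hr
  obtain ⟨wt, p, v, hv⟩ := M.exists_isHighestWeightVector fun i => (r i : ℤ)
  have act_T : ∀ x, M.act x (T v) = T (M.act x v) := fun x =>
    (LinearMap.congr_fun (hT x) v).symm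
  have hTv : T v ∈ M.hwSpace (fun i => (r i : ℤ)) wt :=
    ⟨fun i j hij => by rw [act_T, hv.mem_hwSpace.1 i j hij, map_zero],
      fun i => by rw [act_T, hv.mem_hwSpace.2 i, map_smul]⟩
  obtain ⟨c, hc⟩ := hv.exists_eq_smul hM hr' hTv
  refine ⟨c, LinearMap.ext fun u => ?_⟩
  obtain ⟨w, rfl⟩ := hM.orbitMap_surjective hv.mem_gr hv.ne_zero u
  calc T (M.uact w v) = M.uact w (T v) := LinearMap.congr_fun (commute_uact hT w) v
    _ = c • M.uact w v := by rw [hc, map_smul]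

end GLModule

/-! ### Even reflections -/

theorem exists_nat_of_sl2_relations {K U : Type*} [Field K] [CharZero K] [AddCommGroup U]
    [Module K U] [FiniteDimensional K U] {e f h : Module.End K U} (hef : e * f - f * e = h)
    (hhe : h * e - e * h = (2 : K) • e) (hhf : h * f - f * h = -((2 : K) • f)) {v : U}
    (hv : v ≠ 0) (hev : e v = 0) {c : K} (hhv : h v = c • v) :
    ∃ k : ℕ, c = k ∧ (f ^ k) v ≠ 0 ∧ (f ^ (k + 1)) v = 0 := by
  rcases eq_or_ne h 0 with rfl | h0
  · have hc : c = 0 := (smul_eq_zero.mp hhv.symm).resolve_right hv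
    have hf : f = 0 := by
      refine (smul_eq_zero.mp (neg_eq_zero.mp ?_)).resolve_left (two_ne_zero' K)
      rw [← hhf, zero_mul, mul_zero, sub_zero]
    exact ⟨0, by simp [hc], by simpa using hv, by simp [hf]⟩
  · let _ : LieRing (Module.End K U) := LieRing.ofAssociativeRing
    have triple : IsSl2Triple h e f :=
      { h_ne_zero := h0
        lie_e_f := hef
        lie_h_e_nsmul := by rw [Ring.lie_def, hhe, two_smul, two_nsmul]
        lie_h_f_nsmul := by rw [Ring.lie_def, hhf, two_smul, two_nsmul] }
    have primitive : triple.HasPrimitiveVectorWith v c := ⟨hv, hhv, hev⟩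
    obtain ⟨k, hk⟩ := primitive.exists_nat
    exact ⟨k, hk, primitive.pow_toEnd_f_ne_zero_of_eq_nat hk le_rfl,
      primitive.pow_toEnd_f_eq_zero_of_eq_nat hk⟩

theorem lt_of_swap_lt_swap {ι : Type*} [DecidableEq ι] {r : ι → ℤ} (hr : Function.Injective r)
    {i j : ι} (hij : r j = r i + 1) {p q : ι}
    (hpq : r (Equiv.swap i j p) < r (Equiv.swap i j q)) :
    (p = j ∧ q = i) ∨ (r p < r q ∧ ¬(p = i ∧ q = j)) := by
  have hpi := @hr p i
  have hpj := @hr p j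
  have hqi := @hr q i
  have hqj := @hr q j
  rw [Equiv.swap_apply_def, Equiv.swap_apply_def] at hpq
  split_ifs at hpq <;> grind

namespace GLModule

variable {n m : ℕ} {U : Type*} [AddCommGroup U] [Module ℂ U]

theorem exists_pow_act_matUnit [FiniteDimensional ℂ U] (M : GLModule n m U) {i j : Idx n m}
    (hij : i ≠ j) (hp : idxPar i = idxPar j) {v : U} (hv0 : v ≠ 0)
    (hv : M.act (matUnit i j) v = 0) {wt : Idx n m → ℂ}
    (hwt : ∀ k, M.act (matUnit k k) v = wt k • v) :
    ∃ k : ℕ, wt i - wt j = k ∧ (M.act (matUnit j i) ^ k) v ≠ 0 ∧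
      (M.act (matUnit j i) ^ (k + 1)) v = 0 := by
  let d : Idx n m → ℂ := Pi.single i 1 - Pi.single j 1
  have diagonal_d : Matrix.diagonal d = matUnit i i - matUnit j j := by
    rw [matUnit_self, matUnit_self, Matrix.diagonal_sub]
    rfl
  have hd : d i - d j = 2 := by
    simp [d, hij, hij.symm]
    norm_num
  refine exists_nat_of_sl2_relations (e := M.act (matUnit i j)) (h := M.act (Matrix.diagonal d))
    ?_ ?_ ?_ hv0 hv ?_
  · have h := M.act_sbracket 0 0 _ _ (matUnit_mem_of_idxPar_eq hp)
      (matUnit_mem_of_idxPar_eq hp.symm)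
    simpa [sbracket, diagonal_d] using h.symm
  · ext u
    simp [act_diagonal_act_matUnit, hd]
  · ext u
    simp [act_diagonal_act_matUnit, ← neg_sub (d i), hd]
  · rw [diagonal_d, map_sub, LinearMap.sub_apply, hwt, hwt, sub_smul]

theorem pow_act_mem_gr (M : GLModule n m U) {x : Gl n m} (hx : x ∈ glGr n m 0) {p : ZMod 2} {v : U}
    (hv : v ∈ M.gr p) (t : ℕ) : (M.act x ^ t) v ∈ M.gr p := by
  induction t with
  | zero => exact hv
  | succ t ih =>
    rw [pow_succ', Module.End.mul_apply]
    simpa using M.act_mem 0 p x hx _ ih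

theorem act_matUnit_self_pow_act_matUnit (M : GLModule n m U) (i j k : Idx n m) {v : U} {c : ℂ}
    (hv : M.act (matUnit k k) v = c • v) (t : ℕ) :
    M.act (matUnit k k) ((M.act (matUnit i j) ^ t) v) =
      (c + t * ((Pi.single k 1 : Idx n m → ℂ) i - (Pi.single k 1 : Idx n m → ℂ) j)) •
        (M.act (matUnit i j) ^ t) v := by
  induction t with
  | zero => simpa using hv
  | succ t ih =>
    rw [matUnit_self] at ih ⊢
    rw [pow_succ', Module.End.mul_apply, act_diagonal_act_matUnit, ih, map_smul, ← add_smul]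
    push_cast
    ring_nf

theorem act_matUnit_pow_act_matUnit_eq_zero (M : GLModule n m U) {r : Idx n m → ℤ}
    (hr : Function.Injective r) {i j : Idx n m} (hij : r j = r i + 1) (hp : idxPar i = idxPar j)
    {v : U} (hv : ∀ p q, r p < r q → M.act (matUnit p q) v = 0) (t : ℕ) {p q : Idx n m}
    (hpq : r p < r q) (hpq' : ¬(p = i ∧ q = j)) :
    M.act (matUnit p q) ((M.act (matUnit j i) ^ t) v) = 0 := by
  induction t generalizing p q with
  | zero => exact hv p q hpq
  | succ t ih =>
    have hne : i ≠ j := by rintro rfl; omega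
    rw [pow_succ', Module.End.mul_apply,
      M.act_act (matUnit_mem p q) (matUnit_mem_of_idxPar_eq hp.symm), ih hpq hpq', map_zero,
      smul_zero, add_zero, sbracket, sgn_zero_right, one_smul, map_sub, LinearMap.sub_apply]
    have h_left : M.act (matUnit p q * matUnit j i) ((M.act (matUnit j i) ^ t) v) = 0 := by
      rcases eq_or_ne q j with rfl | hq
      · have hpi : r p ≠ r i := fun h => hpq' ⟨hr h, rfl⟩
        simpa using ih (p := p) (q := i) (by omega) (fun h => hne h.2)
      · simp [hq]
    have h_right : M.act (matUnit j i * matUnit p q) ((M.act (matUnit j i) ^ t) v) = 0 := by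
      rcases eq_or_ne i p with rfl | hi
      · have hqj : r q ≠ r j := fun h => hpq' ⟨rfl, hr h⟩
        simpa using ih (p := j) (q := q) (by omega) (fun h => hne h.1.symm)
      · simp [hi]
    rw [h_left, h_right, sub_zero]

theorem IsHighestWeightVector.exists_swap [FiniteDimensional ℂ U] {M : GLModule n m U}
    {r : Idx n m → ℤ} (hr : Function.Injective r) {wt : Idx n m → ℂ} {p : ZMod 2} {v : U}
    (hv : M.IsHighestWeightVector r wt p v) {i j : Idx n m} (hij : r j = r i + 1)
    (hp : idxPar i = idxPar j) :
    ∃ v', M.IsHighestWeightVector (r ∘ Equiv.swap i j) (wt ∘ Equiv.swap i j) p v' := by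
  have hne : i ≠ j := by rintro rfl; omega
  obtain ⟨hraise, hwt⟩ := hv.mem_hwSpace
  obtain ⟨k, hk, hk0, hk1⟩ :=
    M.exists_pow_act_matUnit hne hp hv.ne_zero (hraise i j (by omega)) hwt
  refine ⟨(M.act (matUnit j i) ^ k) v, ⟨fun a b hab => ?_, fun a => ?_⟩,
    M.pow_act_mem_gr (matUnit_mem_of_idxPar_eq hp.symm) hv.mem_gr k, hk0⟩
  · rcases lt_of_swap_lt_swap hr hij hab with ⟨rfl, rfl⟩ | ⟨hab, hab'⟩
    · rwa [pow_succ', Module.End.mul_apply] at hk1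
    · exact M.act_matUnit_pow_act_matUnit_eq_zero hr hij hp hraise k hab hab'
  · rw [M.act_matUnit_self_pow_act_matUnit j i a (hwt a), ← hk]
    congr 1
    rcases eq_or_ne a i with rfl | hai
    · simp [hne]
    rcases eq_or_ne a j with rfl | haj
    · simp [hne]
    · simp [Equiv.swap_apply_of_ne_of_ne hai haj, hai.symm, haj.symm]

end GLModule

/-! ### The involution `θ` on matrix units -/

/-- The permutation of the standard basis of `V` exchanging the two vectors of each symplectic
pair with index in `T`. -/
def pairSwap {n m : ℕ} (T : Finset (Fin m)) : Idx n m → Idx n m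
  | .inl i => .inl i
  | .inr (.inl a) => if a ∈ T then .inr (.inr a) else .inr (.inl a)
  | .inr (.inr a) => if a ∈ T then .inr (.inl a) else .inr (.inr a)

/-- The position of a basis vector of `V` in an ordering which makes symplectic pairs adjacent, so
that the transposition of a pair is a simple even reflection. -/
def rank {n m : ℕ} : Idx n m → ℤ
  | .inl i => i
  | .inr (.inl a) => n + 2 * a
  | .inr (.inr a) => n + 2 * a + 1

/-- The sign of a basis vector `e` of `V` in `(e, e') = ± 1`, where `e'` is the basis vector not
orthogonal to `e`. -/
def pairSign {n m : ℕ} : Idx n m → ℂ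
  | .inl _ => 1
  | .inr (.inl _) => 1
  | .inr (.inr _) => -1

section Theta

variable {n m : ℕ}

theorem pairSwap_involutive (T : Finset (Fin m)) :
    Function.Involutive (pairSwap T : Idx n m → Idx n m) := by
  rintro (i | a | a)
  · rfl
  all_goals by_cases h : a ∈ T <;> simp [pairSwap, h]

theorem pairSwap_empty : (pairSwap ∅ : Idx n m → Idx n m) = id := by
  funext k
  rcases k with i | a | a <;> simp [pairSwap]

theorem pairSwap_insert {T : Finset (Fin m)} {a : Fin m} (ha : a ∉ T) :
    (pairSwap (insert a T) : Idx n m → Idx n m) =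
      pairSwap T ∘ Equiv.swap (.inr (.inl a)) (.inr (.inr a)) := by
  funext k
  rcases k with i | b | b
  · simp [pairSwap, Equiv.swap_apply_of_ne_of_ne]
  all_goals
    rcases eq_or_ne b a with rfl | hb
    · simp [pairSwap, ha]
    · simp [pairSwap, hb, Equiv.swap_apply_of_ne_of_ne]

theorem idxPar_pairSwap (T : Finset (Fin m)) (i : Idx n m) : idxPar (pairSwap T i) = idxPar i := by
  rcases i with i | a | a <;> simp only [pairSwap] <;> split_ifs <;> rfl

theorem rank_injective : Function.Injective (rank : Idx n m → ℤ) := by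
  rintro (i | a | a) (j | b | b) h <;> simp only [rank] at h <;> grind

theorem rank_pairSwap_lt {i j : Idx n m} (h : rank j < rank i) :
    rank (pairSwap Finset.univ j) < rank (pairSwap Finset.univ i) ∨
      ∃ a, i = .inr (.inr a) ∧ j = .inr (.inl a) := by
  rcases i with i | a | a <;> rcases j with j | b | b <;>
    simp only [rank, pairSwap, Finset.mem_univ, if_true] at h ⊢ <;> grind

theorem theta_apply (x : Gl n m) (a b : Idx n m) :
    theta x a b = -(sgn (idxPar a) (idxPar a + idxPar b) * pairSign a * pairSign b) *
      x (pairSwap Finset.univ b) (pairSwap Finset.univ a) := by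
  rcases a with a | a | a <;> rcases b with b | b | b <;>
    simp [theta, sgn, idxPar, pairSign, pairSwap, Matrix.J, Matrix.mul_apply, Matrix.one_apply,
      Matrix.toBlocks₁₁, Matrix.toBlocks₁₂, Matrix.toBlocks₂₁, Matrix.toBlocks₂₂]

theorem theta_matUnit (i j : Idx n m) :
    theta (matUnit i j) = -(sgn (idxPar j) (idxPar i + idxPar j) *
        pairSign (pairSwap Finset.univ i) * pairSign (pairSwap Finset.univ j)) •
      matUnit (pairSwap Finset.univ j) (pairSwap Finset.univ i) := by
  ext a b
  obtain ⟨a, rfl⟩ := (pairSwap_involutive Finset.univ).surjective a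
  obtain ⟨b, rfl⟩ := (pairSwap_involutive Finset.univ).surjective b
  rw [theta_apply, pairSwap_involutive, pairSwap_involutive, Matrix.smul_apply, smul_eq_mul,
    matUnit, matUnit, Matrix.single_apply, Matrix.single_apply]
  simp only [(pairSwap_involutive _).injective.eq_iff, and_comm (a := j = a)]
  split_ifs with h
  · rw [h.1, h.2, idxPar_pairSwap, idxPar_pairSwap]
    ring_nf
  · rw [mul_zero, mul_zero]

theorem theta_matUnit_self (i : Idx n m) :
    theta (matUnit i i) = -matUnit (pairSwap Finset.univ i) (pairSwap Finset.univ i) := by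
  rw [theta_matUnit]
  rcases i with i | a | a <;> simp [sgn, idxPar, pairSign, pairSwap]

theorem theta_glProj (i : ZMod 2) (x : Gl n m) : theta (glProj i x) = glProj i (theta x) := by
  have h0 := theta_mem (glProj_mem 0 x)
  have h1 := theta_mem (glProj_mem 1 x)
  conv_rhs => rw [← glProj_add x, map_add, map_add]
  rcases zmod_two_cases i with rfl | rfl
  · rw [glProj_of_mem h0, glProj_of_mem_ne one_ne_zero h1, add_zero]
  · rw [glProj_of_mem h1, glProj_of_mem_ne zero_ne_one h0, zero_add]

theorem glProj_mem_osp (i : ZMod 2) {x : Gl n m} (hx : x ∈ osp n m) : glProj i x ∈ osp n m :=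
  (theta_glProj i x).trans (congrArg (glProj i) hx)

theorem add_theta_mem_osp (x : Gl n m) : x + theta x ∈ osp n m := by
  change theta (x + theta x) = x + theta x
  rw [map_add, theta_theta, add_comm]

/-- The Iwasawa decomposition: `θ` maps the root vectors outside the Borel subalgebra of `rank`
into it, up to those in the root subalgebras of the symplectic pairs, which it fixes. -/
theorem span_osp_union_borel : Submodule.span ℂ ({x | x ∈ osp n m ∧ ∃ i, x ∈ glGr n m i} ∪
    {x | ∃ i j : Idx n m, rank i ≤ rank j ∧ x = matUnit i j}) = ⊤ := by
  refine eq_top_of_forall_matUnit_mem fun i j => ?_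
  rcases le_or_gt (rank i) (rank j) with hle | hlt
  · exact Submodule.subset_span (Or.inr ⟨i, j, hle, rfl⟩)
  rcases rank_pairSwap_lt hlt with hlt' | ⟨a, rfl, rfl⟩
  · rw [← add_sub_cancel_right (matUnit i j) (theta (matUnit i j))]
    refine sub_mem (Submodule.subset_span (Or.inl ⟨add_theta_mem_osp _, idxPar i + idxPar j,
      add_mem (matUnit_mem i j) (theta_mem (matUnit_mem i j))⟩)) ?_
    rw [theta_matUnit]
    exact Submodule.smul_mem _ _ (Submodule.subset_span (Or.inr ⟨_, _, hlt'.le, rfl⟩))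
  · refine Submodule.subset_span (Or.inl ⟨(theta_matUnit _ _).trans ?_, _, matUnit_mem _ _⟩)
    simp [sgn, idxPar, pairSign, pairSwap]

end Theta

/-! ### The isomorphism of `U^θ` and `U^*` -/

namespace GLModule

variable {n m : ℕ} {U : Type*} [AddCommGroup U] [Module ℂ U]

theorem IsHighestWeightVector.exists_pairSwap [FiniteDimensional ℂ U] {M : GLModule n m U}
    {wt : Idx n m → ℂ} {p : ZMod 2} {v : U} (hv : M.IsHighestWeightVector rank wt p v)
    (T : Finset (Fin m)) :
    ∃ v', M.IsHighestWeightVector (rank ∘ pairSwap T) (wt ∘ pairSwap T) p v' := by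
  induction T using Finset.induction_on with
  | empty => exact ⟨v, by simpa [pairSwap_empty] using hv⟩
  | insert a T ha ih =>
    obtain ⟨w, hw⟩ := ih
    rw [pairSwap_insert ha]
    exact hw.exists_swap (rank_injective.comp (pairSwap_involutive T).injective)
      (i := .inr (.inl a)) (j := .inr (.inr a)) (by simp [pairSwap, ha, rank]) rfl

theorem IsHighestWeightVector.twist {M : GLModule n m U} {wt : Idx n m → ℂ} {p : ZMod 2} {v : U}
    (hv : M.IsHighestWeightVector rank wt p v) :
    M.twist.IsHighestWeightVector (-(rank ∘ pairSwap Finset.univ))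
      (-(wt ∘ pairSwap Finset.univ)) p v := by
  refine ⟨⟨fun i j hij => ?_, fun i => ?_⟩, hv.mem_gr, hv.ne_zero⟩
  · change M.act (theta (matUnit i j)) v = 0
    rw [theta_matUnit, map_smul, LinearMap.smul_apply,
      hv.mem_hwSpace.1 _ _ (neg_lt_neg_iff.mp hij), smul_zero]
  · change M.act (theta (matUnit i i)) v = _
    rw [theta_matUnit_self, map_neg, LinearMap.neg_apply, hv.mem_hwSpace.2, ← neg_smul]
    rfl

/-- Both modules have highest weight `-(wt ∘ s)` with respect to the ordering `-(rank ∘ s)`, where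
`s` exchanges the two vectors of every symplectic pair. -/
theorem IsIrreducible.twist_isIsomorphic_dual [FiniteDimensional ℂ U] {M : GLModule n m U}
    (hM : M.IsIrreducible) : M.twist.IsIsomorphic M.dual := by
  have := hM.1
  obtain ⟨wt, p, v, hv⟩ := M.exists_isHighestWeightVector rank
  obtain ⟨v', hv'⟩ := hv.exists_pairSwap Finset.univ
  have hr : Function.Injective (rank ∘ pairSwap Finset.univ : Idx n m → ℤ) :=
    rank_injective.comp (pairSwap_involutive _).injective
  obtain ⟨l, hl, -⟩ := hv'.exists_dual hM hr
  exact hv.twist.isIsomorphic hM.twist hM.dual (neg_injective.comp hr) hl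

end GLModule

/-! ### Invariant vectors -/

theorem exists_eq_smul_of_finrank_le_one {K V : Type*} [Field K] [AddCommGroup V]
    [Module K V] [FiniteDimensional K V] {W : Submodule K V} (hW : Module.finrank K W ≤ 1)
    {v w : V} (hv : v ∈ W) (hv0 : v ≠ 0) (hw : w ∈ W) : ∃ c : K, w = c • v := by
  obtain ⟨c, hc⟩ := exists_smul_eq_of_finrank_eq_one
    (hW.antisymm (Submodule.one_le_finrank_iff.mpr (W.ne_bot_iff.mpr ⟨v, hv, hv0⟩)))
    (x := ⟨v, hv⟩) (by simpa using hv0) ⟨w, hw⟩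
  exact ⟨c, (congrArg Subtype.val hc).symm⟩

theorem exp_neg_transpose_mem_orthogonalGroup {ι : Type*} [Fintype ι] [DecidableEq ι]
    {X : Matrix ι ι ℂ} (hX : NormedSpace.exp X ∈ Matrix.orthogonalGroup ι ℂ) :
    NormedSpace.exp (-Xᵀ) ∈ Matrix.orthogonalGroup ι ℂ := by
  have exp_eq : NormedSpace.exp (-Xᵀ) = NormedSpace.exp X := by
    rw [Matrix.exp_neg, Matrix.exp_transpose]
    exact Matrix.inv_eq_left_inv ((Matrix.mem_orthogonalGroup_iff ι ℂ).mp hX)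
  rwa [exp_eq]

namespace GLModule

variable {n m : ℕ} {U U' : Type*} [AddCommGroup U] [Module ℂ U] [AddCommGroup U'] [Module ℂ U']

theorem par_mem_kInv {M : GLModule n m U} {u : U} (hu : u ∈ M.kInv) : M.par u ∈ M.kInv := by
  intro x hx
  have act_glProj : ∀ i, M.act (glProj i x) (M.par u) = 0 := fun i => by
    have h := M.par_act (glProj_mem i x) u
    rw [hu _ (glProj_mem_osp i hx), map_zero] at h
    exact (smul_eq_zero.mp h.symm).resolve_left (by rw [sgn]; split_ifs <;> norm_num)
  rw [← glProj_add x, map_add, LinearMap.add_apply, act_glProj, act_glProj, add_zero]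

theorem apply_act_of_mem_dual_kInv {M : GLModule n m U} {l : Module.Dual ℂ U}
    (hl : l ∈ M.dual.kInv) {x : Gl n m} (hx : x ∈ osp n m) (u : U) : l (M.act x u) = 0 := by
  have apply_act_glProj : ∀ i, l (M.act (glProj i x) u) = 0 := fun i =>
    apply_act_eq_zero (glProj_mem i x) (hl _ (glProj_mem_osp i hx)) u
  rw [← glProj_add x, map_add, LinearMap.add_apply, map_add, apply_act_glProj, apply_act_glProj,
    add_zero]

theorem IsIrreducible.eq_zero_of_mem_dual_kInv {M : GLModule n m U} (hM : M.IsIrreducible)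
    {wt : Idx n m → ℂ} {p : ZMod 2} {v : U} (hv : M.IsHighestWeightVector rank wt p v)
    {l : Module.Dual ℂ U} (hl : l ∈ M.dual.kInv) (hlv : l v = 0) : l = 0 := by
  by_contra hl0
  refine hM.phi_ne_zero hv.mem_gr hv.ne_zero hl0 ?_
  rw [phi_eq_phi (M' := M) (v' := v) (l' := 0) (fun a ha => ha.2) span_osp_union_borel
    (fun a ha => apply_act_of_mem_dual_kInv hl ha.1) (fun _ _ _ => rfl) ?_ (by simpa using hlv)]
  · rfl
  · rintro _ ⟨i, j, hij, rfl⟩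
    exact ⟨_, act_matUnit_of_le rank_injective hv.mem_hwSpace hij,
      act_matUnit_of_le rank_injective hv.mem_hwSpace hij⟩

theorem IsIrreducible.finrank_dual_kInv_le_one [FiniteDimensional ℂ U] {M : GLModule n m U}
    (hM : M.IsIrreducible) : Module.finrank ℂ M.dual.kInv ≤ 1 := by
  have := hM.1
  obtain ⟨wt, p, v, hv⟩ := M.exists_isHighestWeightVector rank
  have eval_injective :
      Function.Injective (Module.Dual.eval ℂ U v ∘ₗ M.dual.kInv.subtype) :=
    (injective_iff_map_eq_zero _).mpr fun l hlv =>
      Subtype.ext (hM.eq_zero_of_mem_dual_kInv hv l.2 hlv)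
  simpa using LinearMap.finrank_le_finrank_of_injective eval_injective

theorem map_kInv_le {M : GLModule n m U} {M' : GLModule n m U'} {e : U →ₗ[ℂ] U'}
    (he : ∀ x u, e (M.act x u) = M'.act x (e u)) : M.kInv.map e ≤ M'.kInv := by
  rintro _ ⟨u, hu, rfl⟩ x hx
  rw [← he, hu x hx, map_zero]

theorem ExpEq.map {e : U →ₗ[ℂ] U'} {T : Module.End ℂ U} {T' : Module.End ℂ U'}
    (he : e ∘ₗ T = T' ∘ₗ e) {u v : U} (h : ExpEq T u v) : ExpEq T' (e u) (e v) := by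
  intro f
  have apply_pow : ∀ k, (T' ^ k) (e u) = e ((T ^ k) u) := fun k =>
    (LinearMap.congr_fun (Module.End.commute_pow_left_of_commute he.symm k) u)
  simpa only [apply_pow, LinearMap.comp_apply] using h (f ∘ₗ e)

theorem map_kInvO_le {M : GLModule n m U} {M' : GLModule n m U'} {e : U →ₗ[ℂ] U'}
    (he : ∀ x u, e (M.act x u) = M'.act x (e u)) : M.kInvO.map e ≤ M'.kInvO := by
  rintro _ ⟨u, hu, rfl⟩
  exact ⟨map_kInv_le he ⟨u, hu.1, rfl⟩, fun X hX =>
    (hu.2 X hX).map (LinearMap.ext fun u => he _ u)⟩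

theorem twist_kInv (M : GLModule n m U) : M.twist.kInv = M.kInv := by
  ext u
  refine forall₂_congr fun x hx => ?_
  change M.act (theta x) u = 0 ↔ M.act x u = 0
  rw [show theta x = x from hx]

theorem kInvO_le_twist_kInvO (M : GLModule n m U) : M.kInvO ≤ M.twist.kInvO := by
  refine fun u hu => ⟨M.twist_kInv.ge hu.1, fun X hX => ?_⟩
  have h := hu.2 (-Xᵀ) (exp_neg_transpose_mem_orthogonalGroup hX)
  change ExpEq (M.act (theta (Matrix.fromBlocks X 0 0 0))) u u
  simpa [theta_fromBlocks] using h

theorem IsIrreducible.exists_injective_map_kInv_le [FiniteDimensional ℂ U] {M : GLModule n m U}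
    (hM : M.IsIrreducible) : ∃ e : U →ₗ[ℂ] Module.Dual ℂ U, Function.Injective e ∧
      M.kInv.map e ≤ M.dual.kInv ∧ M.kInvO.map e ≤ M.dual.kInvO := by
  obtain ⟨e, -, he⟩ := hM.twist_isIsomorphic_dual
  exact ⟨e, e.injective, M.twist_kInv ▸ map_kInv_le he,
    (Submodule.map_mono M.kInvO_le_twist_kInvO).trans (map_kInvO_le he)⟩

theorem IsIrreducible.finrank_kInv_le_one [FiniteDimensional ℂ U] {M : GLModule n m U}
    (hM : M.IsIrreducible) : Module.finrank ℂ M.kInv ≤ 1 := by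
  obtain ⟨e, he, hle, -⟩ := hM.exists_injective_map_kInv_le
  calc Module.finrank ℂ M.kInv = Module.finrank ℂ (M.kInv.map e) :=
        (LinearEquiv.finrank_eq (Submodule.equivMapOfInjective e he M.kInv))
    _ ≤ Module.finrank ℂ M.dual.kInv := Submodule.finrank_mono hle
    _ ≤ 1 := hM.finrank_dual_kInv_le_one

/-! ### Zonal spherical functions -/

theorem exists_mem_gr_of_mem_kInv [FiniteDimensional ℂ U] {M : GLModule n m U}
    (hM : Module.finrank ℂ M.kInv ≤ 1) {u : U} (hu : u ∈ M.kInv) (hu0 : u ≠ 0) :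
    ∃ p, u ∈ M.gr p := by
  obtain ⟨c, hc⟩ := exists_eq_smul_of_finrank_le_one hM hu hu0 (par_mem_kInv hu)
  exact M.exists_mem_gr_of_par_eq_smul hc

theorem isZonal_phi {M : GLModule n m U} {u : U} {l : Module.Dual ℂ U} (hu : u ∈ M.kInv)
    (hl : l ∈ M.dual.kInv) : IsZonal (M.phi u l) := by
  intro x hx w
  constructor
  · simpa [uact_ugι] using apply_act_of_mem_dual_kInv hl hx (M.uact w u)
  · simp [uact_ugι, hu x hx]

theorem IsIrreducible.exists_uact_eq_smul_one [FiniteDimensional ℂ U] {M : GLModule n m U}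
    (hM : M.IsIrreducible) {z : Ug n m} (hz : z ∈ Subalgebra.center ℂ (Ug n m)) :
    ∃ c : ℂ, M.uact z = c • 1 :=
  hM.exists_eq_smul_of_commute fun x => by
    have h : Commute z (ugι x) := (Subalgebra.mem_center_iff.mp hz (ugι x)).symm
    simpa [uact_ugι] using h.map M.uact

theorem IsIrreducible.isZonalSpherical_phi [FiniteDimensional ℂ U] {M : GLModule n m U}
    (hM : M.IsIrreducible) {u : U} {l : Module.Dual ℂ U} (hu : u ∈ M.kInv)
    (hl : l ∈ M.dual.kInv) (hu0 : u ≠ 0) (hl0 : l ≠ 0) : IsZonalSpherical (M.phi u l) := by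
  obtain ⟨p, hp⟩ := exists_mem_gr_of_mem_kInv hM.finrank_kInv_le_one hu hu0
  obtain ⟨q, hq⟩ := exists_mem_gr_of_mem_kInv hM.finrank_dual_kInv_le_one hl hl0
  refine ⟨isZonal_phi hu hl, hM.phi_ne_zero hp hu0 hl0, fun z hz =>
    exists_dualAct_eq_smul (M.phi_ugPar hp hq) (fun z' hz' => ?_) hz⟩
  obtain ⟨c, hc⟩ := hM.exists_uact_eq_smul_one hz'
  exact ⟨c, LinearMap.ext fun w => by simp [hc]⟩

theorem phi_smul_smul (M : GLModule n m U) (c d : ℂ) (u : U) (l : Module.Dual ℂ U) :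
    M.phi (c • u) (d • l) = (c * d) • M.phi u l := by
  ext w
  simp [mul_assoc]

theorem IsIrreducible.zonalSpace_eq_span [FiniteDimensional ℂ U] {M : GLModule n m U}
    (hM : M.IsIrreducible) {A : Submodule ℂ U} {B : Submodule ℂ (Module.Dual ℂ U)}
    (hA : A ≤ M.kInv) (hB : B ≤ M.dual.kInv) {u : U} {l : Module.Dual ℂ U} (hu : u ∈ A)
    (hl : l ∈ B) (hu0 : u ≠ 0) (hl0 : l ≠ 0) :
    M.zonalSpace A B = Submodule.span ℂ {M.phi u l} := by
  refine le_antisymm (Submodule.span_le.mpr ?_)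
    (Submodule.span_mono (Set.singleton_subset_iff.mpr ⟨u, hu, l, hl, rfl⟩))
  rintro _ ⟨u', hu', l', hl', rfl⟩
  obtain ⟨c, rfl⟩ := exists_eq_smul_of_finrank_le_one hM.finrank_kInv_le_one (hA hu) hu0 (hA hu')
  obtain ⟨d, rfl⟩ :=
    exists_eq_smul_of_finrank_le_one hM.finrank_dual_kInv_le_one (hB hl) hl0 (hB hl')
  exact Submodule.mem_span_singleton.mpr ⟨c * d, (M.phi_smul_smul c d u l).symm⟩

theorem IsIrreducible.zonalSpace_spherical [FiniteDimensional ℂ U] {M : GLModule n m U}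
    (hM : M.IsIrreducible) {A : Submodule ℂ U} {B : Submodule ℂ (Module.Dual ℂ U)}
    (hA : A ≤ M.kInv) (hB : B ≤ M.dual.kInv) (hA0 : A ≠ ⊥) (hB0 : B ≠ ⊥) :
    Module.finrank ℂ (M.zonalSpace A B) = 1 ∧
      (∃ f, IsZonalSpherical f ∧ M.zonalSpace A B = Submodule.span ℂ {f}) ∧
      ∀ u ∈ A, ∀ l ∈ B, u ≠ 0 → l ≠ 0 → IsZonalSpherical (M.phi u l) := by
  have isZonalSpherical : ∀ u ∈ A, ∀ l ∈ B, u ≠ 0 → l ≠ 0 → IsZonalSpherical (M.phi u l) :=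
    fun u hu l hl => hM.isZonalSpherical_phi (hA hu) (hB hl)
  obtain ⟨u, hu, hu0⟩ := A.ne_bot_iff.mp hA0
  obtain ⟨l, hl, hl0⟩ := B.ne_bot_iff.mp hB0
  have hspan := hM.zonalSpace_eq_span hA hB hu hl hu0 hl0
  have hphi := isZonalSpherical u hu l hl hu0 hl0
  exact ⟨hspan ▸ finrank_span_singleton hphi.2.1, ⟨_, hphi, hspan⟩, isZonalSpherical⟩

end GLModule

end GLOsp

end

theorem mainTheorem5 (n m : ℕ) {U : Type*} [AddCommGroup U] [Module ℂ U] [FiniteDimensional ℂ U]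
    (M : GLOsp.GLModule n m U) (hM : M.IsIrreducible) :
    -- `U^θ ≅ U^*`
    M.twist.IsIsomorphic M.dual ∧
    -- `dim U^k ≤ 1`
    Module.finrank ℂ M.kInv ≤ 1 ∧
    -- spherical modules, with `U^k` the vectors killed by `osp(n,2m)`
    (M.kInv ≠ ⊥ →
      Module.finrank ℂ (M.zonalSpace M.kInv M.dual.kInv) = 1 ∧
      (∃ f, GLOsp.IsZonalSpherical f ∧ M.zonalSpace M.kInv M.dual.kInv = Submodule.span ℂ {f}) ∧
      ∀ u ∈ M.kInv, ∀ l ∈ M.dual.kInv, u ≠ 0 → l ≠ 0 → GLOsp.IsZonalSpherical (M.phi u l)) ∧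
    -- spherical modules, with `U^k` the vectors killed by `osp(n,2m)` and fixed by `O(n)`
    (M.kInvO ≠ ⊥ →
      Module.finrank ℂ (M.zonalSpace M.kInvO M.dual.kInvO) = 1 ∧
      (∃ f, GLOsp.IsZonalSpherical f ∧ M.zonalSpace M.kInvO M.dual.kInvO = Submodule.span ℂ {f}) ∧
      ∀ u ∈ M.kInvO, ∀ l ∈ M.dual.kInvO, u ≠ 0 → l ≠ 0 →
        GLOsp.IsZonalSpherical (M.phi u l)) := by
  obtain ⟨e, he, hkInv, hkInvO⟩ := hM.exists_injective_map_kInv_le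
  have map_ne_bot : ∀ {A : Submodule ℂ U} {B : Submodule ℂ (Module.Dual ℂ U)},
      A.map e ≤ B → A ≠ ⊥ → B ≠ ⊥ := fun hAB hA =>
    ne_bot_of_le_ne_bot
      (Submodule.map_bot e ▸ (Submodule.map_injective_of_injective he).ne hA) hAB
  exact ⟨hM.twist_isIsomorphic_dual, hM.finrank_kInv_le_one,
    fun h => hM.zonalSpace_spherical le_rfl le_rfl h (map_ne_bot hkInv h),
    fun h => hM.zonalSpace_spherical (fun _ hu => hu.1) (fun _ hl => hl.1) h
      (map_ne_bot hkInvO h)⟩
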